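/- For $k\in\mathbb N$ let $G_k=\{j/2^k-\tfrac12+2^{-k-1}: j=0,\dots,2^k-1\}\subset(-\tfrac12,\tfrac12)$, and let $B_\infty(0,s)=\{x\in\mathbb R^n:\|x\|_\infty\le s\}$. The grid $4r_1G_k^n$ is a hypergrid of $B_\infty(0,2r_1)$; it gets finer as $k$ grows. A quantum query algorithm with access to a unitary $U$ starts in a fixed basis state of a finite-dimensional system containing the registers on which $U$ acts, applies a fixed sequence of operations, each of which is $U$, $U^\dagger$ (a query) or a unitary independent of $U$, measures in the computational basis, and computes its output from the outcome. There is an absolute constant $K$ such that the following holds. Let $n\in\mathbb N$, $r_1>0$, $L>0$, $\rho\in(0,1/3]$ and $\delta\in(0,r_1nL/\rho]$. For all sufficiently large $k$ (depending only on $n,r_1,L,\rho,\delta$), every $b\in\mathbb N$ and every encoding of real numbers by $b$-bit strings, there is a quantum query algorithm, making at most $K\log(n/\rho)$ queries to $U$ and $U^\dagger$ and outputting a vector $\tilde g\in\mathbb R^n$, with the following property. Let $C\subseteq\mathbb R^n$ be convex with $B_\infty(0,2r_1)\subseteq C$, let $f:C\to\mathbb R$ be convex and $L$-Lipschitz (with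 respect to $\|\cdot\|_2$) on $B_\infty(0,2r_1)$, let $\tilde f:4r_1G_k^n\to\mathbb R$ satisfy $|\tilde f(x)-f(x)|\le\delta$ for all $x\in 4r_1G_k^n$, and let $U$ be a unitary with $U|x\rangle|0\rangle=|x\rangle|\tilde f(x)\rangle$ for all $x\in 4r_1G_k^n$, where the second register holds $b$ qubits encoding the value $\tilde f(x)$. Then, when run with $U$, with probability at least $1-\rho$ the output $\tilde g$ satisfies, for all $y\in C$, $$f(y)\ \ge\ f(0)+\langle\tilde g,y\rangle-23^2\sqrt{\frac{\delta n^3L}{\rho r_1}}\,\|y\|_1-2L\sqrt n\,r_1$$ and hence also $$f(y)\ \ge\ f(0)+\langle\tilde g,y\rangle-(23n)^2\sqrt{\frac{\delta L}{\rho r_1}}\,\|y\|_2-2L\sqrt n\,r_1 .$$ -/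

import Mathlib

namespace QuantumQuery

/-! Pure states of a system with finite orthonormal basis `S` are vectors `S → ℂ`;
the basis state `|s⟩` is `Pi.single s 1`; gates are elements of `Matrix.unitaryGroup S ℂ`. -/

/-- One step of a quantum query circuit whose query register has basis `Q` and whose workspace has
basis `W`: a gate on the whole system (not depending on the oracle), a query to `U`,
or a query to the inverse `U†`. -/
inductive Step (Q W : Type) [Fintype Q] [DecidableEq Q] [Fintype W] [DecidableEq W] : Type where
  | gate (V : Matrix.unitaryGroup (Q × W) ℂ) : Step Q W
  | query : Step Q W
  | queryInv : Step Q W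

variable {Q W O : Type} [Fintype Q] [DecidableEq Q] [Fintype W] [DecidableEq W]

/-- The matrix that a step applies, for the oracle `U`: queries act as `U ⊗ I` and `U† ⊗ I`. -/
def Step.toMatrix (U : Matrix.unitaryGroup Q ℂ) : Step Q W → Matrix (Q × W) (Q × W) ℂ
  | .gate V => (V : Matrix (Q × W) (Q × W) ℂ)
  | .query => Matrix.kroneckerMap (· * ·) (U : Matrix Q Q ℂ) (1 : Matrix W W ℂ)
  | .queryInv => Matrix.kroneckerMap (· * ·) (U : Matrix Q Q ℂ).conjTranspose (1 : Matrix W W ℂ)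

/-- The number of oracle queries made by a step. -/
def Step.cost : Step Q W → ℕ
  | .gate _ => 0
  | .query => 1
  | .queryInv => 1

/-- A quantum query algorithm: it starts in a basis state, performs a list of steps, measures the
whole system in the computational basis, and computes an output from the measured basis label. -/
structure Algorithm (Q W O : Type) [Fintype Q] [DecidableEq Q] [Fintype W] [DecidableEq W] where
  init : Q × W
  steps : List (Step Q W)
  out : Q × W → O

/-- The total number of queries to `U` and `U†`. -/
def Algorithm.numQueries (A : Algorithm Q W O) : ℕ := (A.steps.map Step.cost).sum

/-- The state just before the final measurement, when the oracle is `U`. -/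
def Algorithm.finalState (A : Algorithm Q W O) (U : Matrix.unitaryGroup Q ℂ) : Q × W → ℂ :=
  A.steps.foldl (fun ψ s => (s.toMatrix U).mulVec ψ) (Pi.single A.init 1)

open Classical in
/-- The probability (Born rule) that the output of `A`, run with oracle `U`, lies in `E`. -/
noncomputable def Algorithm.prob (A : Algorithm Q W O) (U : Matrix.unitaryGroup Q ℂ)
    (E : Set O) : ℝ :=
  ∑ s : Q × W, if A.out s ∈ E then ‖A.finalState U s‖ ^ 2 else 0

end QuantumQuery

/-- `U` is a standard unitary oracle for `F : X → ℝ`: the answer register consists of `b` qubits,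
`dec` is the real number represented by a bit string (for instance in fixed-point notation), and
`U |x⟩|0⟩ = |x⟩|F x⟩` for all `x`. Nothing is required of `U` on the other basis states. -/
def IsStandardOracle {X : Type} [Fintype X] [DecidableEq X] {b : ℕ}
    (dec : (Fin b → Bool) → ℝ) (F : X → ℝ)
    (U : Matrix.unitaryGroup (X × (Fin b → Bool)) ℂ) : Prop :=
  ∃ enc : X → (Fin b → Bool), (∀ x, dec (enc x) = F x) ∧
    ∀ x, (U : Matrix (X × (Fin b → Bool)) (X × (Fin b → Bool)) ℂ).mulVec
      (Pi.single (x, fun _ => false) 1) = Pi.single (x, enc x) 1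

/-- The ball `B_∞(0, r)` in `ℝⁿ`. -/
def supBall (n : ℕ) (r : ℝ) : Set (EuclideanSpace ℝ (Fin n)) := {x | ∀ i, |x i| ≤ r}

/-- The point with index `j` of the one-dimensional grid
`G_k = { j / 2^k - 1/2 + 2^(-k-1) : 0 ≤ j < 2^k }`. -/
noncomputable def gridCoord (k : ℕ) (j : Fin (2 ^ k)) : ℝ :=
  (j : ℝ) / 2 ^ k - 1 / 2 + 1 / 2 ^ (k + 1)

/-- The point with index `j` of the hypergrid `2 r G_k^n` of `B_∞(0, r)`. -/
noncomputable def gridPoint (n k : ℕ) (r : ℝ) (j : Fin n → Fin (2 ^ k)) :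
    EuclideanSpace ℝ (Fin n) :=
  WithLp.toLp 2 fun i => 2 * r * gridCoord k (j i)

/-! Phase queries with the factor `0.12 / δ` turn the oracle into phases `t f`, up to an error of at
most `0.12`. On a small lattice cube around a centre `z` the function `f` is nearly affine on
average, with slopes given by a subgradient `g` at `z`. A product state with window weights then
becomes nearly a product of plane waves, and a Fourier measurement in every coordinate reads off all
slopes at once, so the number of queries does not grow with the number of coordinates per sample.

Near-affinity at a fixed centre may fail, so `z` is uniformly random on the grid of the half-size
cube. By convexity, `f` lies above its linearisation at `z`; by symmetry of the window the linear
term averages to zero. Hence the mean absolute deviation equals a mean of symmetric second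
differences (`sum_abs_sub_linear_eq_nonlinearity`), and summing these over `z` telescopes to a
boundary term controlled by the Lipschitz constant (`sum_box_second_difference_le`). Markov's
inequality over `z` costs probability `ρ / 2` (`one_sub_le_average`).

At a good centre each coordinate of one sample is wrong with probability at most `1 / 3`
(`sum_tensorPower_fourierMatrix_far_le`): the estimate is an `ℓ²` triangle inequality between the
ideal state, the nonlinearity error and the oracle error. With `O(log (n / ρ))` samples at the same
centre, a majority rule makes all coordinates correct except with probability `ρ / 2`. Finally, a
vector close to a subgradient at a point near `0` yields the affine bound with an additive loss `2 L
√n r` (`affine_lower_bound`). -/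

/-! ### Circuits: phase queries from a standard oracle. -/

section Circuits

open Matrix

/-- A unitary matrix sending a given basis state to a given unit vector. -/
theorem exists_unitary_mulVec_single {S : Type} [Fintype S] [DecidableEq S] (s₀ : S) (v : S → ℂ)
    (hv : ∑ s, ‖v s‖ ^ 2 = 1) :
    ∃ V : unitaryGroup S ℂ, (V : Matrix S S ℂ) *ᵥ Pi.single s₀ 1 = v := by
  have hn : ‖WithLp.toLp 2 v‖ = 1 := by
    rw [EuclideanSpace.norm_eq, Real.sqrt_eq_one]; exact hv
  obtain ⟨B, hB⟩ := Orthonormal.exists_orthonormalBasis_extension_of_card_eq (𝕜 := ℂ)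
    (E := EuclideanSpace ℂ S) (ι := S) (by simp) (v := fun _ => WithLp.toLp 2 v) (s := {s₀})
    ⟨fun _ => by simpa using hn, fun i j hij => absurd (Subsingleton.elim i j) hij⟩
  refine ⟨⟨_, OrthonormalBasis.toMatrix_orthonormalBasis_mem_unitary
    (EuclideanSpace.basisFun S ℂ) B⟩, ?_⟩
  ext s
  rw [mulVec_single_one, col_apply]
  change (EuclideanSpace.basisFun S ℂ).toBasis.toMatrix ⇑B s s₀ = v s
  rw [Module.Basis.toMatrix_apply, hB s₀ (by simp)]
  simp

/-- A unitary matrix preserves the sum of the squared absolute values of the coordinates. -/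
theorem sum_norm_sq_unitary_mulVec {S : Type} [Fintype S] [DecidableEq S] {V : Matrix S S ℂ}
    (hV : V ∈ unitaryGroup S ℂ) (x : S → ℂ) :
    ∑ s, ‖(V *ᵥ x) s‖ ^ 2 = ∑ s, ‖x s‖ ^ 2 := by
  have key : ∀ y : S → ℂ, ((∑ s, ‖y s‖ ^ 2 : ℝ) : ℂ) = star y ⬝ᵥ y := fun y => by
    simp [dotProduct, Complex.conj_mul']
  have : ((∑ s, ‖(V *ᵥ x) s‖ ^ 2 : ℝ) : ℂ) = ((∑ s, ‖x s‖ ^ 2 : ℝ) : ℂ) := by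
    rw [key, key, star_mulVec, ← dotProduct_mulVec, mulVec_mulVec, ← star_eq_conjTranspose,
      mem_unitaryGroup_iff'.1 hV, one_mulVec]
  exact_mod_cast this

/-- The permutation matrix of a permutation is unitary. -/
theorem permMatrix_mem_unitaryGroup {S : Type} [Fintype S] [DecidableEq S] (σ : Equiv.Perm S) :
    σ.permMatrix ℂ ∈ unitaryGroup S ℂ := by
  rw [mem_unitaryGroup_iff, star_eq_conjTranspose, conjTranspose_permMatrix, ← permMatrix_mul]
  simp

/-- A diagonal matrix of phases is unitary. -/
theorem diagonal_exp_mem_unitaryGroup {S : Type} [Fintype S] [DecidableEq S] (θ : S → ℝ) :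
    diagonal (fun s => Complex.exp (θ s * Complex.I)) ∈ unitaryGroup S ℂ := by
  rw [mem_unitaryGroup_iff, star_eq_conjTranspose, diagonal_conjTranspose, diagonal_mul_diagonal,
    ← diagonal_one]
  congr 1
  ext s
  simp [Complex.mul_conj', Complex.norm_exp_ofReal_mul_I]

namespace QuantumQuery

/-- The state in which the workspace is in superposition `c` and the query register holds
a basis state controlled by the workspace. -/
def controlledState {Q W : Type} [DecidableEq Q] (e : W → Q) (c : W → ℂ) : Q × W → ℂ :=
  fun s => if s.1 = e s.2 then c s.2 else 0

theorem one_kronecker_mulVec_controlledState {Q W : Type} [Fintype Q] [DecidableEq Q]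
    [Fintype W] (V : Matrix W W ℂ) (q₀ : Q) (c : W → ℂ) :
    kroneckerMap (· * ·) (1 : Matrix Q Q ℂ) V *ᵥ controlledState (fun _ => q₀) c =
      controlledState (fun _ => q₀) (V *ᵥ c) := by
  ext ⟨q, w⟩
  simp only [mulVec, dotProduct, Fintype.sum_prod_type, controlledState, kroneckerMap_apply,
    one_apply]
  rw [Finset.sum_eq_single q₀]
  · by_cases h : q = q₀ <;> simp [h]
  · intro b _ hb; simp [hb]
  · simp

variable {Q W : Type} [Fintype Q] [DecidableEq Q] [Fintype W] [DecidableEq W]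

/-- By linearity only the columns of `U` at the selected basis states matter. This is why an oracle
specified only on `|x⟩|0⟩` suffices. -/
theorem kronecker_one_mulVec_controlledState (U : Matrix Q Q ℂ) (e e' : W → Q) (c : W → ℂ)
    (h : ∀ w, U *ᵥ Pi.single (e w) 1 = Pi.single (e' w) 1) :
    kroneckerMap (· * ·) U (1 : Matrix W W ℂ) *ᵥ controlledState e c = controlledState e' c := by
  ext ⟨q, w⟩
  have h' := congrFun (h w) q
  rw [mulVec_single_one, col_apply] at h'
  simp only [mulVec, dotProduct, Fintype.sum_prod_type, controlledState, kroneckerMap_apply,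
    one_apply]
  rw [Finset.sum_eq_single (e w), Finset.sum_eq_single w]
  · simp [h', Pi.single_apply]
  · intro b _ hb; simp [Ne.symm hb]
  · simp
  · intro b _ hb
    refine Finset.sum_eq_zero fun x _ => ?_
    by_cases hx : w = x
    · subst hx; simp [hb]
    · simp [hx]
  · simp

theorem one_kronecker_mem_unitaryGroup {V : Matrix W W ℂ} (hV : V ∈ unitaryGroup W ℂ) :
    kroneckerMap (· * ·) (1 : Matrix Q Q ℂ) V ∈ unitaryGroup (Q × W) ℂ :=
  kronecker_mem_unitary (one_mem _) hV

section PhaseQuery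

variable {X : Type} [Fintype X] [DecidableEq X] {b : ℕ}

/-- The permutation swapping the address `x₀` with the address selected by the workspace. -/
def addressPerm (x₀ : X) (p : W → X) : Equiv.Perm ((X × (Fin b → Bool)) × W) :=
  Function.Involutive.toPerm (fun s => ((Equiv.swap x₀ (p s.2) s.1.1, s.1.2), s.2))
    fun s => by simp

theorem permMatrix_addressPerm_mulVec (x₀ : X) (p : W → X) (e : W → X) (c : W → ℂ) :
    (addressPerm (b := b) x₀ p).permMatrix ℂ *ᵥ
        controlledState (fun w => (e w, fun _ => false)) c =
      controlledState (fun w => (Equiv.swap x₀ (p w) (e w), fun _ => false)) c := by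
  rw [permMatrix_mulVec]
  ext ⟨⟨x, y⟩, w⟩
  simp [controlledState, addressPerm, Function.Involutive.toPerm, Prod.ext_iff,
    Equiv.swap_apply_eq_iff]

/-- The five steps that apply the phase `exp (i t F(p w))` with two queries. -/
noncomputable def phaseQuery (dec : (Fin b → Bool) → ℝ) (t : ℝ) (x₀ : X) (p : W → X) :
    List (Step (X × (Fin b → Bool)) W) :=
  [.gate ⟨_, permMatrix_mem_unitaryGroup (addressPerm x₀ p)⟩, .query,
    .gate ⟨_, diagonal_exp_mem_unitaryGroup fun s => t * dec s.1.2⟩, .queryInv,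
    .gate ⟨_, permMatrix_mem_unitaryGroup (addressPerm x₀ p)⟩]

/-- Compute, phase, uncompute: the answer register holds `0` before the query, so `U†` clears it
exactly once the diagonal phase is applied. The address swap is an involution, so the same gate
restores `x₀` and the query register is left unentangled. -/
theorem foldl_phaseQuery {dec : (Fin b → Bool) → ℝ} {F : X → ℝ}
    {U : unitaryGroup (X × (Fin b → Bool)) ℂ} (hU : IsStandardOracle dec F U) (t : ℝ) (x₀ : X)
    (p : W → X) (c : W → ℂ) :
    (phaseQuery dec t x₀ p).foldl (fun ψ s => (s.toMatrix U).mulVec ψ)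
        (controlledState (fun _ => (x₀, fun _ => false)) c) =
      controlledState (fun _ => (x₀, fun _ => false))
        (fun w => Complex.exp (↑(t * F (p w)) * Complex.I) * c w) := by
  obtain ⟨enc, hdec, henc⟩ := hU
  have hinv : ∀ x, (U : Matrix (X × (Fin b → Bool)) (X × (Fin b → Bool)) ℂ).conjTranspose *ᵥ
      Pi.single (x, enc x) 1 = Pi.single (x, fun _ => false) 1 := fun x => by
    rw [← henc x, mulVec_mulVec, ← star_eq_conjTranspose, mem_unitaryGroup_iff'.1 U.2, one_mulVec]
  simp only [phaseQuery, List.foldl_cons, List.foldl_nil, Step.toMatrix]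
  rw [permMatrix_addressPerm_mulVec x₀ p (fun _ => x₀)]
  simp only [Equiv.swap_apply_left]
  rw [kronecker_one_mulVec_controlledState _ _ (fun w => (p w, enc (p w))) _ fun w => henc _]
  have hd : diagonal (fun s : (X × (Fin b → Bool)) × W =>
      Complex.exp (↑(t * dec s.1.2) * Complex.I)) *ᵥ
      controlledState (fun w => (p w, enc (p w))) c =
      controlledState (fun w => (p w, enc (p w)))
        (fun w => Complex.exp (↑(t * F (p w)) * Complex.I) * c w) := by
    ext ⟨q, w⟩
    rw [mulVec_diagonal]
    by_cases h : q = (p w, enc (p w))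
    · simp [controlledState, h, hdec]
    · simp [controlledState, h]
  rw [hd, kronecker_one_mulVec_controlledState _ _ (fun w => (p w, fun _ => false)) _
    fun w => hinv _, permMatrix_addressPerm_mulVec x₀ p p]
  simp

theorem foldl_flatMap_phaseQuery {dec : (Fin b → Bool) → ℝ} {F : X → ℝ}
    {U : unitaryGroup (X × (Fin b → Bool)) ℂ} (hU : IsStandardOracle dec F U) (t : ℝ) (x₀ : X)
    (l : List (W → X)) (c : W → ℂ) :
    (l.flatMap (phaseQuery dec t x₀)).foldl (fun ψ s => (s.toMatrix U).mulVec ψ)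
        (controlledState (fun _ => (x₀, fun _ => false)) c) =
      controlledState (fun _ => (x₀, fun _ => false))
        (fun w => (l.map fun p => Complex.exp (↑(t * F (p w)) * Complex.I)).prod * c w) := by
  induction l generalizing c with
  | nil => simp
  | cons p l ih =>
    rw [List.flatMap_cons, List.foldl_append, foldl_phaseQuery hU, ih]
    congr 1
    ext w
    simp only [List.map_cons, List.prod_cons]
    ring

theorem sum_cost_flatMap_phaseQuery (dec : (Fin b → Bool) → ℝ) (t : ℝ) (x₀ : X)
    (l : List (W → X)) :
    ((l.flatMap (phaseQuery dec t x₀)).map Step.cost).sum = 2 * l.length := by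
  induction l with
  | nil => simp
  | cons p l ih =>
    rw [List.flatMap_cons, List.map_append, List.sum_append, ih]
    simp [phaseQuery, Step.cost]
    ring

open Classical in
/-- Preparing a workspace state, applying `m` phase queries at addresses selected by the
workspace, applying a workspace unitary and measuring the workspace costs `2 m` queries. -/
theorem exists_algorithm_phaseQueries {O : Type} {m : ℕ} [Nonempty X]
    (dec : (Fin b → Bool) → ℝ) (t : ℝ) (p : Fin m → W → X) (c : W → ℂ)
    (hc : ∑ w, ‖c w‖ ^ 2 = 1) {V : Matrix W W ℂ} (hV : V ∈ unitaryGroup W ℂ) (out : W → O) :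
    ∃ A : Algorithm (X × (Fin b → Bool)) W O, A.numQueries = 2 * m ∧
      ∀ (F : X → ℝ) (U : unitaryGroup (X × (Fin b → Bool)) ℂ), IsStandardOracle dec F U →
        ∀ E : Set O, A.prob U E = ∑ w, if out w ∈ E then
          ‖(V *ᵥ fun w => (∏ i, Complex.exp (↑(t * F (p i w)) * Complex.I)) * c w) w‖ ^ 2
          else 0 := by
  obtain ⟨x₀⟩ := ‹Nonempty X›
  have hW : Nonempty W := by
    by_contra h
    rw [not_nonempty_iff] at h
    simp at hc
  obtain ⟨w₀⟩ := hW
  set q₀ : X × (Fin b → Bool) := (x₀, fun _ => false) with hq₀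
  obtain ⟨G, hG⟩ := exists_unitary_mulVec_single (q₀, w₀) (controlledState (fun _ => q₀) c) (by
    rw [← hc, Fintype.sum_prod_type, Finset.sum_eq_single q₀]
    · simp [controlledState]
    · intro q _ hq; simp [controlledState, hq]
    · simp)
  refine ⟨⟨(q₀, w₀), .gate G :: ((List.ofFn p).flatMap (phaseQuery dec t x₀) ++
    [.gate ⟨_, one_kronecker_mem_unitaryGroup hV⟩]), fun s => out s.2⟩, ?_, fun F U hU E => ?_⟩
  · simp only [Algorithm.numQueries, List.map_cons, List.map_append, List.sum_cons,
      List.sum_append, sum_cost_flatMap_phaseQuery, List.length_ofFn]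
    simp [Step.cost]
  · simp only [Algorithm.prob, Algorithm.finalState, List.foldl_cons, List.foldl_append,
      List.foldl_nil]
    have h1 : (Step.toMatrix U (.gate G)).mulVec (Pi.single (q₀, w₀) 1) =
      controlledState (fun _ => q₀) c := hG
    rw [h1, foldl_flatMap_phaseQuery hU]
    simp only [Step.toMatrix]
    rw [one_kronecker_mulVec_controlledState, Fintype.sum_prod_type, Finset.sum_eq_single q₀]
    · simp [controlledState, List.map_ofFn, List.prod_ofFn, ← hq₀]
    · intro q _ hq; simp [controlledState, hq, ← hq₀]
    · simp

end PhaseQuery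

end QuantumQuery

end Circuits

/-! ### Fourier measurement with a triangular window. -/

section Fourier

open Matrix

/-- The tensor power of a matrix. -/
def tensorPower (ι : Type) {α : Type} [Fintype ι] (V : Matrix α α ℂ) :
    Matrix (ι → α) (ι → α) ℂ :=
  of fun h y => ∏ i, V (h i) (y i)

theorem tensorPower_mulVec_prod {ι α : Type} [Fintype ι] [DecidableEq ι] [Fintype α]
    (V : Matrix α α ℂ) (x : ι → α → ℂ) (h : ι → α) :
    (tensorPower ι V *ᵥ fun y => ∏ i, x i (y i)) h = ∏ i, (V *ᵥ x i) (h i) := by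
  simp only [mulVec, dotProduct, tensorPower, of_apply, ← Finset.prod_mul_distrib]
  rw [Finset.prod_univ_sum, Fintype.piFinset_univ]

theorem tensorPower_mem_unitaryGroup {ι α : Type} [Fintype ι] [DecidableEq ι] [Fintype α]
    [DecidableEq α] {V : Matrix α α ℂ} (hV : V ∈ unitaryGroup α ℂ) :
    tensorPower ι V ∈ unitaryGroup (ι → α) ℂ := by
  rw [mem_unitaryGroup_iff] at hV ⊢
  ext h h'
  have key : ∀ a a', ∑ b, V a b * star (V a' b) = if a = a' then 1 else 0 := fun a a' => by
    have := congrFun (congrFun hV a) a'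
    rwa [mul_apply, one_apply] at this
  simp only [mul_apply, star_apply, tensorPower, of_apply, star_prod, ← Finset.prod_mul_distrib]
  rw [← Fintype.piFinset_univ, ← Finset.prod_univ_sum (fun _ => Finset.univ)
    (fun i b => V (h i) b * star (V (h' i) b))]
  simp only [key, one_apply, funext_iff]
  rw [Finset.prod_ite_zero]
  simp

/-- Blockwise action of `1 ⊗ V`. -/
theorem one_kronecker_mulVec_apply {Q W : Type} [Fintype Q] [DecidableEq Q] [Fintype W]
    (V : Matrix W W ℂ) (ψ : Q × W → ℂ) (q : Q) (w : W) :
    (kroneckerMap (· * ·) (1 : Matrix Q Q ℂ) V *ᵥ ψ) (q, w) = (V *ᵥ fun w => ψ (q, w)) w := by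
  simp only [mulVec, dotProduct, Fintype.sum_prod_type, kroneckerMap_apply, one_apply]
  rw [Finset.sum_eq_single q]
  · simp
  · intro b _ hb; simp [hb.symm]
  · simp

open Classical in
/-- One-coordinate marginal of a product distribution. -/
theorem sum_prod_marginal {ι α : Type} [Fintype ι] [DecidableEq ι] [Fintype α]
    (q : ι → α → ℝ) (hq : ∀ i, ∑ a, q i a = 1) (c : ι) (P : α → Prop) :
    ∑ h : ι → α, (if P (h c) then ∏ i, q i (h i) else 0) = ∑ a, if P a then q c a else 0 := by
  have h1 : ∀ h : ι → α, (if P (h c) then ∏ i, q i (h i) else 0) =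
      ∏ i, (if i = c ∧ ¬ P (h i) then 0 else q i (h i)) := fun h => by
    split_ifs with hP
    · refine Finset.prod_congr rfl fun i _ => ?_
      rw [if_neg]
      rintro ⟨rfl, h2⟩
      exact h2 hP
    · exact (Finset.prod_eq_zero (Finset.mem_univ c) (by simp [hP])).symm
  simp only [h1]
  rw [← Fintype.piFinset_univ, ← Finset.prod_univ_sum (fun _ => Finset.univ)
    (fun i a => if i = c ∧ ¬ P a then 0 else q i a), Finset.prod_eq_single c]
  · refine Finset.sum_congr rfl fun a _ => ?_
    by_cases h : P a <;> simp [h]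
  · intro i _ hi
    simp [hi, hq]
  · simp

open Classical in
/-- A Chernoff bound: if each of `m` independent samples is bad with probability at most `p`,
then at least `s` samples are bad with probability at most `(1 + p) ^ m / 2 ^ s`. -/
theorem sum_prod_many_bad_le {α : Type} [Fintype α] (m s : ℕ) (q : α → ℝ) (hq0 : ∀ a, 0 ≤ q a)
    (hq1 : ∑ a, q a = 1) (P : α → Prop) (p : ℝ) (hp : ∑ a, (if P a then q a else 0) ≤ p) :
    ∑ h : Fin m → α, (if s ≤ (Finset.univ.filter fun i => P (h i)).card
      then ∏ i, q (h i) else 0) ≤ (1 + p) ^ m / 2 ^ s := by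
  rw [le_div_iff₀ (by positivity), Finset.sum_mul]
  have hnn : 0 ≤ ∑ a, (if P a then q a else 0) :=
    Finset.sum_nonneg fun a _ => by split_ifs <;> simp [hq0]
  calc _ ≤ ∑ h : Fin m → α, ∏ i, q (h i) * (if P (h i) then 2 else 1) := by
        refine Finset.sum_le_sum fun h _ => ?_
        rw [Finset.prod_mul_distrib, Finset.prod_ite]
        simp only [Finset.prod_const, one_pow, mul_one]
        have h0 : 0 ≤ ∏ i, q (h i) := Finset.prod_nonneg fun i _ => hq0 _
        split_ifs with hs
        · exact mul_le_mul_of_nonneg_left (pow_le_pow_right₀ (by norm_num) hs) h0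
        · rw [zero_mul]; positivity
    _ = (1 + ∑ a, (if P a then q a else 0)) ^ m := by
        rw [← Fintype.piFinset_univ, ← Finset.prod_univ_sum (fun _ => Finset.univ)
          (fun _ a => q a * (if P a then 2 else 1))]
        have e : ∑ a, q a * (if P a then 2 else 1) = ∑ a, q a + ∑ a, (if P a then q a else 0) := by
          rw [← Finset.sum_add_distrib]
          refine Finset.sum_congr rfl fun a _ => ?_
          split_ifs <;> ring
        rw [Finset.prod_const, Finset.card_univ, Fintype.card_fin, e, hq1]
    _ ≤ (1 + p) ^ m := by gcongr

/-- The standard primitive `N`-th root of unity. -/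
noncomputable def rootOfUnity (N : ℕ) : ℂ := Complex.exp (2 * Real.pi * Complex.I / N)

theorem norm_rootOfUnity (N : ℕ) : ‖rootOfUnity N‖ = 1 := by
  have : rootOfUnity N = Complex.exp ((2 * Real.pi / N : ℝ) * Complex.I) := by
    rw [rootOfUnity]; congr 1; push_cast; ring
  rw [this, Complex.norm_exp_ofReal_mul_I]

theorem rootOfUnity_ne_zero (N : ℕ) : rootOfUnity N ≠ 0 := Complex.exp_ne_zero _

/-- The matrix of the inverse quantum Fourier transform. -/
noncomputable def fourierMatrix (N : ℕ) : Matrix (Fin N) (Fin N) ℂ :=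
  of fun h j => ((√N : ℝ) : ℂ)⁻¹ * ((rootOfUnity N ^ (h : ℕ))⁻¹) ^ (j : ℕ)

theorem fourierMatrix_mem_unitaryGroup {N : ℕ} (hN : 0 < N) :
    fourierMatrix N ∈ unitaryGroup (Fin N) ℂ := by
  have hprim : IsPrimitiveRoot (rootOfUnity N) N := Complex.isPrimitiveRoot_exp N hN.ne'
  have hz := rootOfUnity_ne_zero N
  have hN' : (N : ℂ) ≠ 0 := by exact_mod_cast hN.ne'
  have hs : ((√N : ℝ) : ℂ)⁻¹ * ((√N : ℝ) : ℂ)⁻¹ = (N : ℂ)⁻¹ := by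
    rw [← mul_inv, ← Complex.ofReal_mul, Real.mul_self_sqrt (by positivity)]; simp
  have hconj : star (rootOfUnity N) = (rootOfUnity N)⁻¹ := by
    rw [Complex.star_def, Complex.inv_def, Complex.normSq_eq_norm_sq, norm_rootOfUnity]; simp
  rw [mem_unitaryGroup_iff]
  ext h h'
  set q : ℂ := (rootOfUnity N ^ (h : ℕ))⁻¹ * rootOfUnity N ^ (h' : ℕ) with hq
  have hsum : (fourierMatrix N * star (fourierMatrix N)) h h' =
      (N : ℂ)⁻¹ * ∑ j ∈ Finset.range N, q ^ j := by
    rw [mul_apply, Finset.mul_sum, ← Fin.sum_univ_eq_sum_range (fun j => (N : ℂ)⁻¹ * q ^ j)]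
    refine Finset.sum_congr rfl fun j _ => ?_
    simp only [star_apply, fourierMatrix, of_apply, star_mul', star_inv₀, star_pow, hconj,
      inv_pow, inv_inv, hq, mul_pow]
    rw [← hs, Complex.star_def, Complex.conj_ofReal]
    ring
  rw [hsum, one_apply]
  split_ifs with hh
  · have : q = 1 := by rw [hq, hh, inv_mul_cancel₀ (pow_ne_zero _ hz)]
    simp [this, hN']
  · have hq1 : q ≠ 1 := fun h1 => hh (by
      rw [hq, inv_mul_eq_one₀ (pow_ne_zero _ hz)] at h1
      exact Fin.ext (hprim.pow_inj h.2 h'.2 h1))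
    have hqN : q ^ N = 1 := by
      have e : ∀ i : ℕ, (rootOfUnity N ^ i) ^ N = 1 := fun i => by
        rw [← pow_mul, mul_comm, pow_mul, hprim.pow_eq_one, one_pow]
      rw [hq, mul_pow, inv_pow, e, e, inv_one, one_mul]
    rw [geom_sum_eq hq1, hqN]
    simp

/-- The Fourier transform turns a shift into multiplication by roots of unity. -/
theorem fourierMatrix_mulVec_shift {N : ℕ} (a : ℕ → ℂ) (h0 : a 0 = 0) (hN : a N = 0)
    (h : Fin N) :
    (fourierMatrix N *ᵥ fun j => a (j + 1)) h =
      rootOfUnity N ^ (h : ℕ) * (fourierMatrix N *ᵥ fun j => a j) h := by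
  have hz : rootOfUnity N ^ (h : ℕ) ≠ 0 := pow_ne_zero _ (rootOfUnity_ne_zero N)
  simp only [mulVec, dotProduct, fourierMatrix, of_apply, mul_assoc, ← Finset.mul_sum]
  rw [mul_left_comm]
  congr 1
  rw [Fin.sum_univ_eq_sum_range (fun j => (rootOfUnity N ^ (h : ℕ))⁻¹ ^ j * a (j + 1)),
    Fin.sum_univ_eq_sum_range (fun j => (rootOfUnity N ^ (h : ℕ))⁻¹ ^ j * a j)]
  -- A sum over `N + 1` terms is split at its last and at its first term; both vanish, so the shift
  -- produces no boundary contribution.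
  have e := Finset.sum_range_succ (fun j => (rootOfUnity N ^ (h : ℕ))⁻¹ ^ j * a j) N
  rw [Finset.sum_range_succ', h0, hN, mul_zero, mul_zero, add_zero, add_zero] at e
  rw [← e, Finset.mul_sum]
  refine Finset.sum_congr rfl fun j _ => ?_
  rw [pow_succ]
  field_simp

/-- Mean square deviation of the measured root of unity. -/
theorem sum_norm_sub_sq_mul_fourierMatrix {N : ℕ} (hpos : 0 < N) (a : ℕ → ℂ) (h0 : a 0 = 0)
    (hN : a N = 0) (u : ℂ) :
    ∑ h : Fin N, ‖rootOfUnity N ^ (h : ℕ) - u‖ ^ 2 * ‖(fourierMatrix N *ᵥ fun j => a j) h‖ ^ 2 =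
      ∑ j ∈ Finset.range N, ‖a (j + 1) - u * a j‖ ^ 2 := by
  -- Parseval for the sequence `a (j + 1) - u a j`, whose transform is `(ω ^ h - u)` times that of
  -- `a`.
  rw [← Fin.sum_univ_eq_sum_range (fun j => ‖a (j + 1) - u * a j‖ ^ 2),
    ← sum_norm_sq_unitary_mulVec (fourierMatrix_mem_unitaryGroup hpos)
      (fun j : Fin N => a (j + 1) - u * a j)]
  refine Finset.sum_congr rfl fun h _ => ?_
  have : (fun j : Fin N => a (j + 1) - u * a j) =
      (fun j : Fin N => a (j + 1)) - u • (fun j : Fin N => a j) := by ext; simp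
  rw [this, mulVec_sub, mulVec_smul, Pi.sub_apply, Pi.smul_apply, fourierMatrix_mulVec_shift a h0 hN,
    smul_eq_mul, ← sub_mul, norm_mul, mul_pow]

/-- The triangular window with peak at `H` and support `{1, …, 2 H - 1}`. -/
def triangle (H j : ℕ) : ℕ := min j (2 * H - j)

theorem sum_triangle_sq (H : ℕ) :
    ∑ j ∈ Finset.range (2 * H + 1), (triangle H j : ℝ) ^ 2 = H * (2 * H ^ 2 + 1) / 3 := by
  have hsq : ∀ n : ℕ, ∑ j ∈ Finset.range n, (j : ℝ) ^ 2 = n * (n - 1) * (2 * n - 1) / 6 := by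
    intro n
    induction n with
    | zero => simp
    | succ n ih => rw [Finset.sum_range_succ, ih]; push_cast; ring
  rw [show 2 * H + 1 = H + (H + 1) by ring, Finset.sum_range_add]
  have e1 : ∑ j ∈ Finset.range H, (triangle H j : ℝ) ^ 2 = ∑ j ∈ Finset.range H, (j : ℝ) ^ 2 :=
    Finset.sum_congr rfl fun j hj => by
      rw [Finset.mem_range] at hj
      rw [triangle, min_eq_left (by omega)]
  have e2 : ∑ j ∈ Finset.range (H + 1), (triangle H (H + j) : ℝ) ^ 2 =
      ∑ j ∈ Finset.range (H + 1), (j : ℝ) ^ 2 := by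
    rw [← Finset.sum_range_reflect]
    refine Finset.sum_congr rfl fun j hj => ?_
    rw [Finset.mem_range] at hj
    congr 2
    rw [triangle, min_eq_right (by omega)]
    omega
  rw [e1, e2, hsq, hsq]
  push_cast
  ring

theorem sum_triangle_sub_sq_le (H : ℕ) :
    ∑ j ∈ Finset.range (2 * H + 1), ((triangle H (j + 1) : ℝ) - triangle H j) ^ 2 ≤ 2 * H := by
  rw [Finset.sum_range_succ]
  -- Truncated subtraction makes `triangle H` vanish at `2 H + 1` as well as at `2 H`.
  have h1 : ((triangle H (2 * H + 1) : ℝ) - triangle H (2 * H)) ^ 2 = 0 := by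
    simp [triangle]
  rw [h1, add_zero]
  calc _ ≤ ∑ j ∈ Finset.range (2 * H), (1 : ℝ) := by
        refine Finset.sum_le_sum fun j hj => ?_
        rw [Finset.mem_range] at hj
        rw [sq_le_one_iff_abs_le_one, abs_le]
        have a1 : triangle H (j + 1) ≤ triangle H j + 1 := by simp only [triangle]; omega
        have a2 : triangle H j ≤ triangle H (j + 1) + 1 := by simp only [triangle]; omega
        have b1 : (triangle H (j + 1) : ℝ) ≤ triangle H j + 1 := by exact_mod_cast a1
        have b2 : (triangle H j : ℝ) ≤ triangle H (j + 1) + 1 := by exact_mod_cast a2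
        constructor <;> linarith
    _ = 2 * H := by simp

/-- The normalised triangular window. -/
noncomputable def window (H j : ℕ) : ℝ := triangle H j / √(H * (2 * H ^ 2 + 1) / 3)

theorem sum_window_sq {H : ℕ} (hH : 0 < H) :
    ∑ j : Fin (2 * H + 1), window H j ^ 2 = 1 := by
  rw [Fin.sum_univ_eq_sum_range (fun j => window H j ^ 2)]
  have : (0 : ℝ) < H * (2 * H ^ 2 + 1) / 3 := by positivity
  simp only [window, div_pow]
  rw [← Finset.sum_div, sum_triangle_sq, Real.sq_sqrt this.le, div_self this.ne']

theorem window_rev (H : ℕ) (j : Fin (2 * H + 1)) : window H (j.rev : ℕ) = window H j := by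
  have : triangle H (j.rev : ℕ) = triangle H j := by
    simp only [triangle, Fin.val_rev]; omega
  rw [window, window, this]

theorem sum_window_sub_sq_le {H : ℕ} (hH : 0 < H) :
    ∑ j ∈ Finset.range (2 * H + 1), (window H (j + 1) - window H j) ^ 2 ≤ 3 / H ^ 2 := by
  have : (0 : ℝ) < H * (2 * H ^ 2 + 1) / 3 := by positivity
  have hH' : (0 : ℝ) < H := by exact_mod_cast hH
  simp only [window, ← sub_div, div_pow]
  rw [← Finset.sum_div, Real.sq_sqrt this.le]
  calc _ ≤ 2 * (H : ℝ) / (H * (2 * H ^ 2 + 1) / 3) := by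
        gcongr; exact sum_triangle_sub_sq_le H
    _ ≤ 3 / H ^ 2 := by
        rw [div_le_div_iff₀ this (by positivity)]
        nlinarith

open Classical in
/-- Phase estimation with the triangular window: the measured root of unity is far from
`exp (i θ)` with small probability. -/
theorem sum_fourierMatrix_window_far_le {H : ℕ} (hH : 0 < H) (θ : ℝ) :
    ∑ h : Fin (2 * H + 1), (if 8 / (H : ℝ) ≤
        ‖rootOfUnity (2 * H + 1) ^ (h : ℕ) - Complex.exp (θ * Complex.I)‖
      then ‖(fourierMatrix (2 * H + 1) *ᵥ fun j => (window H j : ℂ) *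
        Complex.exp (↑(θ * ((j : ℝ) - H)) * Complex.I)) h‖ ^ 2 else 0) ≤ 3 / 64 := by
  have hH' : (0 : ℝ) < H := by exact_mod_cast hH
  -- Chebyshev: the mean square deviation is at most `3 / H ^ 2`, and the threshold squared is `64 /
  -- H ^ 2`.
  have hcheb : ∀ h : Fin (2 * H + 1), (if 8 / (H : ℝ) ≤
        ‖rootOfUnity (2 * H + 1) ^ (h : ℕ) - Complex.exp (θ * Complex.I)‖
      then ‖(fourierMatrix (2 * H + 1) *ᵥ fun j => (window H j : ℂ) *
        Complex.exp (↑(θ * ((j : ℝ) - H)) * Complex.I)) h‖ ^ 2 else 0) ≤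
      H ^ 2 / 64 * (‖rootOfUnity (2 * H + 1) ^ (h : ℕ) - Complex.exp (θ * Complex.I)‖ ^ 2 *
      ‖(fourierMatrix (2 * H + 1) *ᵥ fun j => (window H j : ℂ) *
        Complex.exp (↑(θ * ((j : ℝ) - H)) * Complex.I)) h‖ ^ 2) := fun h => by
    split_ifs with hh
    · rw [← mul_assoc]
      refine le_mul_of_one_le_left (by positivity) ?_
      have : (8 / (H : ℝ)) ^ 2 ≤
        ‖rootOfUnity (2 * H + 1) ^ (h : ℕ) - Complex.exp (θ * Complex.I)‖ ^ 2 := by gcongr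
      calc (1 : ℝ) = H ^ 2 / 64 * (8 / H) ^ 2 := by field_simp; norm_num
        _ ≤ _ := by gcongr
    · positivity
  refine (Finset.sum_le_sum fun h _ => hcheb h).trans ?_
  rw [← Finset.mul_sum]
  have := sum_norm_sub_sq_mul_fourierMatrix (N := 2 * H + 1) (by omega)
    (fun j => (window H j : ℂ) * Complex.exp (↑(θ * ((j : ℝ) - H)) * Complex.I))
    (by simp [window, triangle]) (by simp [window, triangle]) (Complex.exp (θ * Complex.I))
  rw [this]
  -- The phase advances by exactly `θ` per step, so only the increment of the window survives.
  have e : ∀ j : ℕ, ‖(window H (j + 1) : ℂ) *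
      Complex.exp (↑(θ * (((j + 1 : ℕ) : ℝ) - H)) * Complex.I) - Complex.exp (θ * Complex.I) *
      ((window H j : ℂ) * Complex.exp (↑(θ * ((j : ℝ) - H)) * Complex.I))‖ ^ 2 =
      (window H (j + 1) - window H j) ^ 2 := fun j => by
    have : Complex.exp (↑(θ * (((j + 1 : ℕ) : ℝ) - H)) * Complex.I) =
        Complex.exp (θ * Complex.I) * Complex.exp (↑(θ * ((j : ℝ) - H)) * Complex.I) := by
      rw [← Complex.exp_add]; congr 1; push_cast; ring
    rw [this, show ∀ a b u v : ℂ, a * (u * v) - u * (b * v) = (a - b) * (u * v) by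
      intros; ring, norm_mul, norm_mul, Complex.norm_exp_ofReal_mul_I,
      Complex.norm_exp_ofReal_mul_I, ← Complex.ofReal_sub, Complex.norm_real]
    simp
  simp only [e]
  calc _ ≤ (H : ℝ) ^ 2 / 64 * (3 / H ^ 2) := by gcongr; exact sum_window_sub_sq_le hH
    _ = 3 / 64 := by field_simp

theorem norm_exp_mul_I_sub_exp_mul_I (x y : ℝ) :
    ‖Complex.exp (x * Complex.I) - Complex.exp (y * Complex.I)‖ = 2 * |Real.sin ((x - y) / 2)| := by
  have : Complex.exp (x * Complex.I) - Complex.exp (y * Complex.I) =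
      Complex.exp (y * Complex.I) * (Complex.exp (Complex.I * ↑(x - y)) - 1) := by
    rw [mul_sub, ← Complex.exp_add]; push_cast; ring_nf
  rw [this, norm_mul, Complex.norm_exp_ofReal_mul_I, one_mul, Complex.norm_exp_I_mul_ofReal_sub_one]
  simp

theorem norm_exp_mul_I_sub_exp_mul_I_le (x y : ℝ) :
    ‖Complex.exp (x * Complex.I) - Complex.exp (y * Complex.I)‖ ≤ |x - y| := by
  rw [norm_exp_mul_I_sub_exp_mul_I]
  have := Real.abs_sin_le_abs (x := (x - y) / 2)
  rw [abs_div, abs_two] at this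
  linarith

/-- Multiplying the trivial bound `2` by the Lipschitz bound makes the squared norm linear in the
phase error, so an `ℓ¹` average of phase errors controls an `ℓ²` distance of states. -/
theorem sq_norm_exp_mul_I_sub_exp_mul_I_le (x y : ℝ) :
    ‖Complex.exp (x * Complex.I) - Complex.exp (y * Complex.I)‖ ^ 2 ≤ 2 * |x - y| := by
  have h1 := norm_exp_mul_I_sub_exp_mul_I_le x y
  have h2 : ‖Complex.exp (x * Complex.I) - Complex.exp (y * Complex.I)‖ ≤ 2 := by
    rw [norm_exp_mul_I_sub_exp_mul_I]
    linarith [Real.abs_sin_le_one ((x - y) / 2)]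
  rw [sq]
  exact mul_le_mul h2 h1 (norm_nonneg _) (by norm_num)

theorem abs_sub_le_norm_exp_mul_I_sub_exp_mul_I {x y : ℝ} (h : |x - y| ≤ Real.pi) :
    |x - y| ≤ Real.pi / 2 *
      ‖Complex.exp (x * Complex.I) - Complex.exp (y * Complex.I)‖ := by
  rw [norm_exp_mul_I_sub_exp_mul_I]
  have h2 : |(x - y) / 2| = |x - y| / 2 := by rw [abs_div, abs_two]
  have := Real.mul_abs_le_abs_sin (x := (x - y) / 2) (by rw [h2]; linarith)
  rw [h2] at this
  have hpi := Real.pi_pos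
  calc |x - y| = Real.pi / 2 * (2 * (2 / Real.pi * (|x - y| / 2))) := by field_simp
    _ ≤ _ := by gcongr

/-- Weighted Cauchy–Schwarz. Summed over coordinates, with the weights equal to the `ℓ²` norms of
the three parts, it gives the triangle inequality without square roots. -/
theorem sq_norm_add_add_le {a b c : ℂ} {α β γ : ℝ} (hα : 0 < α) (hβ : 0 < β) (hγ : 0 < γ) :
    ‖a + b + c‖ ^ 2 ≤ (α + β + γ) * (‖a‖ ^ 2 / α + ‖b‖ ^ 2 / β + ‖c‖ ^ 2 / γ) := by
  calc ‖a + b + c‖ ^ 2 ≤ (‖a‖ + ‖b‖ + ‖c‖) ^ 2 := by gcongr; exact norm_add₃_le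
    _ ≤ _ := by
      have := Finset.sum_sq_le_sum_mul_sum_of_sq_le_mul (Finset.univ : Finset (Fin 3))
        (r := ![‖a‖, ‖b‖, ‖c‖]) (f := ![α, β, γ]) (g := ![‖a‖ ^ 2 / α, ‖b‖ ^ 2 / β, ‖c‖ ^ 2 / γ])
        (by intro i _; fin_cases i <;> simp <;> positivity)
        (by intro i _; fin_cases i <;> simp <;> positivity)
        (by intro i _; refine le_of_eq ?_; fin_cases i <;> simp <;> field_simp)
      simpa [Fin.sum_univ_three] using this

theorem sum_prod_window_sq (n : ℕ) {H : ℕ} (hH : 0 < H) :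
    ∑ y : Fin n → Fin (2 * H + 1), ∏ i, window H (y i) ^ 2 = 1 := by
  rw [← Fintype.piFinset_univ, ← Finset.prod_univ_sum (fun _ => Finset.univ)
    (fun _ (a : Fin (2 * H + 1)) => window H a ^ 2)]
  simp [sum_window_sq hH]

open Classical in
/-- Phase estimation in `n` dimensions is robust: if the phases `P` are uniformly close to `R`,
and `R` is on average close to a linear function with slopes `θ`, then each coordinate of the
Fourier measurement is far from the corresponding slope with probability at most `1 / 3`. -/
theorem sum_tensorPower_fourierMatrix_far_le {n H : ℕ} (hH : 0 < H) (θ : Fin n → ℝ) (c₀ : ℝ)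
    (P R : (Fin n → Fin (2 * H + 1)) → ℝ) (hPR : ∀ y, |P y - R y| ≤ 12 / 100)
    (hR : ∑ y, (∏ i, window H (y i) ^ 2) * |R y - (c₀ + ∑ i, θ i * ((y i : ℝ) - H))| ≤ 288 / 10000)
    (c : Fin n) :
    ∑ h, (if 8 / (H : ℝ) ≤
        ‖rootOfUnity (2 * H + 1) ^ (h c : ℕ) - Complex.exp (θ c * Complex.I)‖
      then ‖(tensorPower (Fin n) (fourierMatrix (2 * H + 1)) *ᵥ fun y =>
        Complex.exp (P y * Complex.I) * ∏ i, (window H (y i) : ℂ)) h‖ ^ 2 else 0) ≤ 1 / 3 := by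
  set V := tensorPower (Fin n) (fourierMatrix (2 * H + 1)) with hVdef
  have hF := fourierMatrix_mem_unitaryGroup (N := 2 * H + 1) (by omega)
  have hV : V ∈ unitaryGroup (Fin n → Fin (2 * H + 1)) ℂ := tensorPower_mem_unitaryGroup hF
  set lin : (Fin n → Fin (2 * H + 1)) → ℝ := fun y => c₀ + ∑ i, θ i * ((y i : ℝ) - H)
  set w : (Fin n → Fin (2 * H + 1)) → ℂ := fun y => ∏ i, (window H (y i) : ℂ)
  have hw : ∀ y, ‖w y‖ ^ 2 = ∏ i, window H (y i) ^ 2 := fun y => by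
    simp [w, norm_prod, ← Finset.prod_pow]
  have hwsum : ∑ y, ‖w y‖ ^ 2 = 1 := by simp only [hw]; exact sum_prod_window_sq n hH
  -- `ψ` is the ideal product state, `d₁` the error from nonlinearity, `d₂` the error of the oracle
  -- values.
  set ψ : (Fin n → Fin (2 * H + 1)) → ℂ := fun y => Complex.exp (lin y * Complex.I) * w y
  set d₁ : (Fin n → Fin (2 * H + 1)) → ℂ := fun y =>
    (Complex.exp (R y * Complex.I) - Complex.exp (lin y * Complex.I)) * w y
  set d₂ : (Fin n → Fin (2 * H + 1)) → ℂ := fun y =>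
    (Complex.exp (P y * Complex.I) - Complex.exp (R y * Complex.I)) * w y
  have hsplit : (fun y => Complex.exp (P y * Complex.I) * w y) = ψ + d₁ + d₂ := by
    ext y; simp only [ψ, d₁, d₂, Pi.add_apply]; ring
  have hd₁ : ∑ h, ‖(V *ᵥ d₁) h‖ ^ 2 ≤ 576 / 10000 := by
    rw [sum_norm_sq_unitary_mulVec hV]
    calc _ ≤ ∑ y, 2 * ((∏ i, window H (y i) ^ 2) * |R y - lin y|) := by
          refine Finset.sum_le_sum fun y _ => ?_
          simp only [d₁]
          rw [norm_mul, mul_pow, hw]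
          have h1 := sq_norm_exp_mul_I_sub_exp_mul_I_le (R y) (lin y)
          have h2 : 0 ≤ ∏ i, window H (y i) ^ 2 := by positivity
          nlinarith [mul_le_mul_of_nonneg_right h1 h2]
      _ ≤ _ := by rw [← Finset.mul_sum]; linarith
  have hd₂ : ∑ h, ‖(V *ᵥ d₂) h‖ ^ 2 ≤ 144 / 10000 := by
    rw [sum_norm_sq_unitary_mulVec hV]
    calc _ ≤ ∑ y, (12 / 100) ^ 2 * ‖w y‖ ^ 2 := by
          refine Finset.sum_le_sum fun y _ => ?_
          simp only [d₂]
          rw [norm_mul, mul_pow]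
          gcongr
          exact (norm_exp_mul_I_sub_exp_mul_I_le _ _).trans (hPR y)
      _ ≤ _ := by rw [← Finset.mul_sum, hwsum]; norm_num
  have hψ : ∑ h, (if 8 / (H : ℝ) ≤
        ‖rootOfUnity (2 * H + 1) ^ (h c : ℕ) - Complex.exp (θ c * Complex.I)‖
      then ‖(V *ᵥ ψ) h‖ ^ 2 else 0) ≤ 3 / 64 := by
    set x : Fin n → Fin (2 * H + 1) → ℂ := fun i j => (window H j : ℂ) *
      Complex.exp (↑(θ i * ((j : ℝ) - H)) * Complex.I)
    have hψx : ψ = Complex.exp (c₀ * Complex.I) • fun y => ∏ i, x i (y i) := by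
      ext y
      simp only [ψ, lin, w, x, Pi.smul_apply, smul_eq_mul, Finset.prod_mul_distrib]
      rw [← Complex.exp_sum, mul_left_comm, ← Complex.exp_add, mul_comm]
      congr 2
      push_cast
      rw [add_mul, Finset.sum_mul]
    have hnorm : ∀ h, ‖(V *ᵥ ψ) h‖ ^ 2 =
        ∏ i, ‖(fourierMatrix (2 * H + 1) *ᵥ x i) (h i)‖ ^ 2 := fun h => by
      rw [hψx, mulVec_smul, Pi.smul_apply, hVdef, tensorPower_mulVec_prod, smul_eq_mul, norm_mul,
        Complex.norm_exp_ofReal_mul_I, one_mul, norm_prod, Finset.prod_pow]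
    simp only [hnorm]
    rw [sum_prod_marginal (fun i a => ‖(fourierMatrix (2 * H + 1) *ᵥ x i) a‖ ^ 2) _ c
      (fun a => 8 / (H : ℝ) ≤
        ‖rootOfUnity (2 * H + 1) ^ (a : ℕ) - Complex.exp (θ c * Complex.I)‖)]
    · exact sum_fourierMatrix_window_far_le hH (θ c)
    · intro i
      rw [sum_norm_sq_unitary_mulVec hF, ← sum_window_sq hH]
      refine Finset.sum_congr rfl fun j _ => ?_
      simp only [x]
      rw [norm_mul, Complex.norm_exp_ofReal_mul_I]
      simp
  -- The weights are the square roots of `3 / 64` (rounded up), `576 / 10000` and `144 / 10000`; the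
  -- result is about `0.577 ^ 2 < 1 / 3`.
  calc _ ≤ ∑ h, (217 / 1000 + 24 / 100 + 12 / 100) * ((if 8 / (H : ℝ) ≤
        ‖rootOfUnity (2 * H + 1) ^ (h c : ℕ) - Complex.exp (θ c * Complex.I)‖
        then ‖(V *ᵥ ψ) h‖ ^ 2 else 0) / (217 / 1000) + ‖(V *ᵥ d₁) h‖ ^ 2 / (24 / 100) +
          ‖(V *ᵥ d₂) h‖ ^ 2 / (12 / 100)) := by
        refine Finset.sum_le_sum fun h _ => ?_
        rw [hsplit, mulVec_add, mulVec_add]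
        split_ifs
        · exact sq_norm_add_add_le (by norm_num) (by norm_num) (by norm_num)
        · positivity
    _ ≤ (217 / 1000 + 24 / 100 + 12 / 100) * ((3 / 64) / (217 / 1000) +
          (576 / 10000) / (24 / 100) + (144 / 10000) / (12 / 100)) := by
        rw [← Finset.mul_sum, Finset.sum_add_distrib, Finset.sum_add_distrib, ← Finset.sum_div,
          ← Finset.sum_div, ← Finset.sum_div]
        gcongr
    _ ≤ 1 / 3 := by norm_num

end Fourier

/-! ### Existence of subgradients. -/

/-- A convex function has a subgradient at every interior point around which it is continuous. -/
theorem ConvexOn.exists_subgradient {E : Type*} [NormedAddCommGroup E] [InnerProductSpace ℝ E]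
    [CompleteSpace E] {C B : Set E} {f : E → ℝ} (hf : ConvexOn ℝ C f) (hB : IsOpen B)
    (hBconv : Convex ℝ B) (hBC : B ⊆ C) (hcont : ContinuousOn f B) {x : E} (hx : x ∈ B) :
    ∃ g : E, ∀ y ∈ C, f x + inner ℝ g (y - x) ≤ f y := by
  have hfB : ConvexOn ℝ B f := hf.subset hBC hBconv
  set s : Set (E × ℝ) := {p | p.1 ∈ B ∧ f p.1 < p.2} with hs
  have hopen : IsOpen s := by
    have h1 : ContinuousOn (fun p : E × ℝ => p.2 - f p.1) (B ×ˢ Set.univ) :=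
      continuousOn_snd.sub (hcont.comp continuousOn_fst fun p hp => hp.1)
    have h2 := h1.isOpen_inter_preimage (hB.prod isOpen_univ) (isOpen_Ioi (a := (0 : ℝ)))
    convert h2 using 1
    ext p
    simp [hs]
  -- Separate `(x, f x)` from the open strict epigraph over `B`; the hyperplane is not vertical
  -- because the epigraph contains a point directly above `x`.
  obtain ⟨F, hF⟩ := geometric_hahn_banach_open_point (x := (x, f x)) hfB.convex_strict_epigraph
    hopen (fun h => lt_irrefl _ h.2)
  set κ : ℝ := F (0, 1) with hκ
  set ℓ : E →L[ℝ] ℝ := F.comp (ContinuousLinearMap.inl ℝ E ℝ) with hℓ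
  have hdec : ∀ y u, F (y, u) = ℓ y + u * κ := fun y u => by
    have : ((y, u) : E × ℝ) = (y, 0) + u • (0, 1) := by simp
    rw [this, map_add, map_smul]; simp [hℓ, hκ]
  have hκneg : κ < 0 := by
    have := hF (x, f x + 1) ⟨hx, by simp⟩
    rw [hdec, hdec] at this
    linarith
  have hloc : ∀ y ∈ B, ℓ y + f y * κ ≤ ℓ x + f x * κ := fun y hy => by
    refine le_of_forall_pos_lt_add fun ε hε => ?_
    have hpos : 0 < ε / (-κ) := div_pos hε (by linarith)
    have := hF (y, f y + ε / (-κ)) ⟨hy, by simpa using hpos⟩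
    rw [hdec, hdec, add_mul] at this
    have e : ε / (-κ) * κ = -ε := by
      have := hκneg.ne
      field_simp
    linarith
  refine ⟨(InnerProductSpace.toDual ℝ E).symm ((-κ)⁻¹ • ℓ), fun y hy => ?_⟩
  rw [InnerProductSpace.toDual_symm_apply]
  -- From local to global: a point of the segment from `x` to `y` close to `x` lies in `B`, and
  -- convexity on `C` scales the inequality there up to `y`.
  have hcurve : Continuous fun t : ℝ => x + t • (y - x) := by fun_prop
  have hnear : ∀ᶠ t in nhds (0 : ℝ), x + t • (y - x) ∈ B :=
    hcurve.continuousAt.eventually_mem (by simpa using hB.mem_nhds hx)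
  obtain ⟨t, ⟨htB, ht1⟩, ht0⟩ := ((hnear.filter_mono nhdsWithin_le_nhds).and
    (Ioc_mem_nhdsGT (zero_lt_one' ℝ))).and self_mem_nhdsWithin |>.exists
  have ht0' : 0 < t := ht0
  have h1 := hloc _ htB
  have h2 := hf.2 (hBC hx) hy (sub_nonneg.2 ht1.2) ht0'.le (by ring)
  have e : (1 - t) • x + t • y = x + t • (y - x) := by module
  rw [e, smul_eq_mul, smul_eq_mul] at h2
  rw [map_add, map_smul, smul_eq_mul] at h1
  rw [_root_.smul_apply, smul_eq_mul]
  have h3 : t * ℓ (y - x) ≤ t * (f y - f x) * (-κ) := by nlinarith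
  have h4 : ℓ (y - x) ≤ (f y - f x) * (-κ) := by
    rw [mul_assoc] at h3; exact le_of_mul_le_mul_left h3 ht0'
  have h5 : (-κ)⁻¹ * ℓ (y - x) ≤ f y - f x := by
    rw [inv_mul_le_iff₀ (by linarith)]; linarith
  linarith

/-! ### Averages of symmetric differences over integer boxes. -/

/-- Shifting an integer box moves few points out of it. -/
theorem card_box_sdiff_shift_mul_le {n : ℕ} (lo : ℤ) (M H : ℕ) (ν : Fin n → ℤ)
    (hν : ∀ c, |ν c| ≤ H) :
    ((Fintype.piFinset fun _ : Fin n => Finset.Ico lo (lo + M)).filter fun z =>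
      z + ν ∉ Fintype.piFinset fun _ : Fin n => Finset.Ico lo (lo + M)).card * M ≤
      n * H * M ^ n := by
  classical
  set I := Finset.Ico lo (lo + M) with hI
  have hcardI : I.card = M := by simp [hI]
  set J : Fin n → Finset ℤ := fun c => I.filter fun x => x + ν c ∉ I with hJ
  have hJcard : ∀ c, (J c).card ≤ H := fun c => by
    have hc := abs_le.1 (hν c)
    have hsub : J c ⊆ if 0 ≤ ν c then Finset.Ico (lo + M - ν c) (lo + M)
        else Finset.Ico lo (lo - ν c) := by
      intro x hx
      simp only [hJ, hI, Finset.mem_filter, Finset.mem_Ico] at hx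
      split_ifs <;> rw [Finset.mem_Ico] <;> omega
    refine (Finset.card_le_card hsub).trans ?_
    split_ifs <;> simp only [Int.card_Ico] <;> omega
  -- A point that leaves the box does so in some coordinate `c`, where at most `H` of the `M` values
  -- are possible.
  have hsub : ((Fintype.piFinset fun _ : Fin n => I).filter fun z =>
      z + ν ∉ Fintype.piFinset fun _ : Fin n => I) ⊆
      Finset.univ.biUnion fun c => Fintype.piFinset fun i => if i = c then J c else I := by
    intro z hz
    simp only [Finset.mem_filter, Fintype.mem_piFinset, not_forall] at hz
    obtain ⟨hz, c, hc⟩ := hz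
    simp only [Finset.mem_biUnion, Finset.mem_univ, true_and, Fintype.mem_piFinset]
    refine ⟨c, fun i => ?_⟩
    split_ifs with h
    · subst h
      exact Finset.mem_filter.2 ⟨hz i, hc⟩
    · exact hz i
  have hone : ∀ c : Fin n,
      (Fintype.piFinset fun i => if i = c then J c else I).card * M ≤ H * M ^ n := fun c => by
    rw [Fintype.card_piFinset]
    have : ∀ i, (if i = c then J c else I).card = if i = c then (J c).card else M := fun i => by
      split_ifs <;> simp [hcardI]
    simp only [this]
    rw [← Finset.mul_prod_erase Finset.univ _ (Finset.mem_univ c), if_pos rfl, Finset.prod_congr rfl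
      (fun i hi => if_neg (Finset.ne_of_mem_erase hi)), Finset.prod_const,
      Finset.card_erase_of_mem (Finset.mem_univ c), Finset.card_univ, Fintype.card_fin, mul_assoc,
      ← pow_succ, Nat.sub_add_cancel (Fin.pos c)]
    exact Nat.mul_le_mul_right _ (hJcard c)
  calc _ ≤ (∑ c : Fin n, (Fintype.piFinset fun i => if i = c then J c else I).card) * M :=
        Nat.mul_le_mul_right _ ((Finset.card_le_card hsub).trans Finset.card_biUnion_le)
    _ = ∑ c : Fin n, (Fintype.piFinset fun i => if i = c then J c else I).card * M :=
        Finset.sum_mul _ _ _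
    _ ≤ ∑ _c : Fin n, H * M ^ n := Finset.sum_le_sum fun c _ => hone c
    _ = n * H * M ^ n := by simp [mul_assoc]

/-- The sum over an integer box of the second differences of a function with bounded
first differences is a boundary term. -/
theorem sum_box_second_difference_le {n : ℕ} (lo : ℤ) (M H : ℕ) (ν : Fin n → ℤ)
    (hν : ∀ c, |ν c| ≤ H) (φ : (Fin n → ℤ) → ℝ) (D : ℝ) (hD : 0 ≤ D)
    (hφ : ∀ x, (x ∈ Fintype.piFinset fun _ : Fin n => Finset.Ico lo (lo + M)) ∨
      (x + ν ∈ Fintype.piFinset fun _ : Fin n => Finset.Ico lo (lo + M)) →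
      |φ (x + ν) - φ x| ≤ D) :
    M * ∑ z ∈ Fintype.piFinset fun _ : Fin n => Finset.Ico lo (lo + M),
      ((φ (z + ν) - φ z) + (φ (z - ν) - φ z)) ≤ 2 * (n * H * M ^ n * D) := by
  classical
  set A := Fintype.piFinset fun _ : Fin n => Finset.Ico lo (lo + (M : ℤ)) with hA
  set A' := A.map (Equiv.subRight ν).toEmbedding with hA'
  have hmem : ∀ x, x ∈ A' ↔ x + ν ∈ A := fun x => by
    simp only [hA', Finset.mem_map_equiv]; rfl
  -- With `Δ z = φ (z + ν) - φ z`, the summand is `Δ z - Δ (z - ν)`. The sums of `Δ` over `A` and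
  -- over its translate `A'` cancel on the overlap.
  have hsum : ∑ z ∈ A, ((φ (z + ν) - φ z) + (φ (z - ν) - φ z)) =
      ∑ z ∈ A \ A', (φ (z + ν) - φ z) - ∑ z ∈ A' \ A, (φ (z + ν) - φ z) := by
    rw [Finset.sum_sdiff_sub_sum_sdiff, hA', Finset.sum_map, ← Finset.sum_sub_distrib]
    refine Finset.sum_congr rfl fun z _ => ?_
    simp
    ring
  have hcard : (A' \ A).card = (A \ A').card :=
    Finset.card_sdiff_comm (by simp [hA'])
  have hAA' : A \ A' = A.filter fun z => z + ν ∉ A := by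
    ext z; simp [hmem]
  have hbound : ((A \ A').card : ℝ) * M ≤ n * H * M ^ n := by
    rw [hAA']; exact_mod_cast card_box_sdiff_shift_mul_le lo M H ν hν
  have h1 : ∑ z ∈ A \ A', (φ (z + ν) - φ z) ≤ (A \ A').card * D := by
    rw [← nsmul_eq_mul]
    exact Finset.sum_le_card_nsmul _ _ _ fun z hz =>
      (le_abs_self _).trans (hφ z (Or.inl (Finset.mem_sdiff.1 hz).1))
  have h2 : -∑ z ∈ A' \ A, (φ (z + ν) - φ z) ≤ (A \ A').card * D := by
    rw [← hcard, ← nsmul_eq_mul, ← Finset.sum_neg_distrib]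
    exact Finset.sum_le_card_nsmul _ _ _ fun z hz =>
      (neg_le_abs _).trans (hφ z (Or.inr ((hmem z).1 (Finset.mem_sdiff.1 hz).1)))
  rw [hsum]
  have hM : (0 : ℝ) ≤ M := by positivity
  nlinarith [mul_le_mul_of_nonneg_right hbound hD, mul_le_mul_of_nonneg_left (add_le_add h1 h2) hM]

/-- The average increment under a random symmetric shift, over a uniformly random
point of an integer box. -/
theorem sum_box_sum_symmetric_shift_le {n : ℕ} {Y : Type} [Fintype Y] (lo : ℤ) (M H : ℕ)
    (ν : Y → Fin n → ℤ) (hν : ∀ y c, |ν y c| ≤ H) (w : Y → ℝ) (hw0 : ∀ y, 0 ≤ w y)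
    (hw1 : ∑ y, w y = 1) (σ : Y ≃ Y) (hσw : ∀ y, w (σ y) = w y) (hσν : ∀ y, ν (σ y) = -ν y)
    (φ : (Fin n → ℤ) → ℝ) (D : ℝ) (hD : 0 ≤ D)
    (hφ : ∀ y x, (x ∈ Fintype.piFinset fun _ : Fin n => Finset.Ico lo (lo + M)) ∨
      (x + ν y ∈ Fintype.piFinset fun _ : Fin n => Finset.Ico lo (lo + M)) →
      |φ (x + ν y) - φ x| ≤ D) :
    M * ∑ z ∈ Fintype.piFinset fun _ : Fin n => Finset.Ico lo (lo + M),
      ∑ y, w y * (φ (z + ν y) - φ z) ≤ n * H * M ^ n * D := by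
  set A := Fintype.piFinset fun _ : Fin n => Finset.Ico lo (lo + (M : ℤ)) with hA
  -- The symmetry `σ` pairs each shift with its opposite, turning first differences into second
  -- differences.
  have hdouble : ∀ z, 2 * ∑ y, w y * (φ (z + ν y) - φ z) =
      ∑ y, w y * ((φ (z + ν y) - φ z) + (φ (z - ν y) - φ z)) := fun z => by
    have : ∑ y, w y * (φ (z + ν y) - φ z) = ∑ y, w y * (φ (z - ν y) - φ z) := by
      rw [← Equiv.sum_comp σ]
      refine Finset.sum_congr rfl fun y _ => ?_
      rw [hσw, hσν, sub_eq_add_neg z]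
    simp only [mul_add, Finset.sum_add_distrib]
    rw [← this]
    ring
  have key : 2 * (M * ∑ z ∈ A, ∑ y, w y * (φ (z + ν y) - φ z)) ≤ 2 * (n * H * M ^ n * D) := by
    calc _ = M * ∑ z ∈ A, 2 * ∑ y, w y * (φ (z + ν y) - φ z) := by
          rw [← Finset.mul_sum]; ring
      _ = ∑ y, w y * (M * ∑ z ∈ A, ((φ (z + ν y) - φ z) + (φ (z - ν y) - φ z))) := by
          simp only [hdouble]
          rw [Finset.sum_comm, Finset.mul_sum]
          refine Finset.sum_congr rfl fun y _ => ?_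
          rw [← Finset.mul_sum]
          ring
      _ ≤ ∑ y, w y * (2 * (n * H * M ^ n * D)) := Finset.sum_le_sum fun y _ =>
          mul_le_mul_of_nonneg_left
            (sum_box_second_difference_le lo M H (ν y) (hν y) φ D hD (hφ y)) (hw0 y)
      _ = 2 * (n * H * M ^ n * D) := by rw [← Finset.sum_mul, hw1, one_mul]
  linarith

/-! ### Sampling, majority vote and Markov's inequality. -/

section Sampling

open Matrix

variable {n H : ℕ}

/-- The state obtained by applying the Fourier transform in each coordinate to the windowed
state with phases `P`. -/
noncomputable def fourierState (n H : ℕ) (P : (Fin n → Fin (2 * H + 1)) → ℝ) :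
    (Fin n → Fin (2 * H + 1)) → ℂ :=
  tensorPower (Fin n) (fourierMatrix (2 * H + 1)) *ᵥ fun y =>
    Complex.exp (P y * Complex.I) * ∏ i, (window H (y i) : ℂ)

theorem sum_norm_sq_fourierState (hH : 0 < H) (P : (Fin n → Fin (2 * H + 1)) → ℝ) :
    ∑ h, ‖fourierState n H P h‖ ^ 2 = 1 := by
  unfold fourierState
  rw [sum_norm_sq_unitary_mulVec (tensorPower_mem_unitaryGroup
    (fourierMatrix_mem_unitaryGroup (by omega))), ← sum_prod_window_sq n hH]
  refine Finset.sum_congr rfl fun y _ => ?_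
  rw [norm_mul, Complex.norm_exp_ofReal_mul_I, one_mul, norm_prod, ← Finset.prod_pow]
  simp

open Classical in
/-- There is an algorithm with `2 m` queries that samples a uniformly random centre `z` and, for
this centre, `m` independent outcomes of the Fourier measurement. -/
theorem exists_fourierSampling_algorithm (hH : 0 < H) {X Z O : Type} [Fintype X] [DecidableEq X]
    [Nonempty X] [Fintype Z] [DecidableEq Z] [Nonempty Z] {b : ℕ} (dec : (Fin b → Bool) → ℝ) (t : ℝ)
    (m : ℕ) (pt : Z → (Fin n → Fin (2 * H + 1)) → X)
    (out : (Fin m → Fin n → Fin (2 * H + 1)) → O) :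
    ∃ A : QuantumQuery.Algorithm (X × (Fin b → Bool)) (Z × (Fin m → Fin n → Fin (2 * H + 1))) O,
      A.numQueries = 2 * m ∧
      ∀ (F : X → ℝ) (U : unitaryGroup (X × (Fin b → Bool)) ℂ), IsStandardOracle dec F U →
        ∀ E : Set O, A.prob U E = ∑ z, (Fintype.card Z : ℝ)⁻¹ * ∑ h, if out h ∈ E then
          ∏ i, ‖fourierState n H (fun y => t * F (pt z y)) (h i)‖ ^ 2 else 0 := by
  set r : ℂ := ((√(Fintype.card Z : ℝ) : ℝ) : ℂ)⁻¹ with hr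
  have hr2 : ‖r‖ ^ 2 = (Fintype.card Z : ℝ)⁻¹ := by
    rw [hr, norm_inv, Complex.norm_real, Real.norm_of_nonneg (by positivity), inv_pow,
      Real.sq_sqrt (by positivity)]
  have hcard : (Fintype.card Z : ℝ) ≠ 0 := by exact_mod_cast Fintype.card_ne_zero
  -- One uniform superposition of centres is shared by all `m` samples. The final transform acts
  -- trivially on `Z`, so the centre behaves as a classical random variable, given which the samples
  -- are independent.
  set c : Z × (Fin m → Fin n → Fin (2 * H + 1)) → ℂ := fun w => r * ∏ i, ∏ j, (window H (w.2 i j) : ℂ) with hc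
  have hcsum : ∑ w, ‖c w‖ ^ 2 = 1 := by
    rw [Fintype.sum_prod_type]
    have : ∀ h : Fin m → Fin n → Fin (2 * H + 1), (∏ i, ∏ j, ‖(window H (h i j) : ℂ)‖) ^ 2 =
        ∏ i, ∏ j, window H (h i j) ^ 2 := fun h => by
      simp [← Finset.prod_pow]
    simp only [hc, norm_mul, norm_prod, mul_pow, hr2, this, ← Finset.mul_sum]
    rw [← Fintype.piFinset_univ, ← Finset.prod_univ_sum (fun _ => Finset.univ)
      (fun _ (y : Fin n → Fin (2 * H + 1)) => ∏ j, window H (y j) ^ 2), sum_prod_window_sq n hH]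
    simp [hcard]
  have hV : tensorPower (Fin m) (tensorPower (Fin n) (fourierMatrix (2 * H + 1))) ∈
      unitaryGroup (Fin m → Fin n → Fin (2 * H + 1)) ℂ := tensorPower_mem_unitaryGroup (tensorPower_mem_unitaryGroup
        (fourierMatrix_mem_unitaryGroup (by omega)))
  obtain ⟨A, hA, hprob⟩ := QuantumQuery.exists_algorithm_phaseQueries dec t
    (fun i (w : Z × (Fin m → Fin n → Fin (2 * H + 1))) => pt w.1 (w.2 i)) c hcsum
    (QuantumQuery.one_kronecker_mem_unitaryGroup (Q := Z) hV) (fun w => out w.2)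
  refine ⟨A, hA, fun F U hU E => ?_⟩
  rw [hprob F U hU E, Fintype.sum_prod_type]
  refine Finset.sum_congr rfl fun z _ => ?_
  rw [Finset.mul_sum]
  refine Finset.sum_congr rfl fun h _ => ?_
  rw [mul_ite, mul_zero]
  refine if_congr Iff.rfl ?_ rfl
  rw [one_kronecker_mulVec_apply]
  have : (fun h : Fin m → Fin n → Fin (2 * H + 1) => (∏ i, Complex.exp (↑(t * F (pt z (h i))) * Complex.I)) * c (z, h)) =
      r • fun h => ∏ i, (Complex.exp (↑(t * F (pt z (h i))) * Complex.I) *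
        ∏ j, (window H (h i j) : ℂ)) := by
    ext h
    simp only [hc, Pi.smul_apply, smul_eq_mul, Finset.prod_mul_distrib]
    ring
  simp only
  rw [this, mulVec_smul, Pi.smul_apply, tensorPower_mulVec_prod _ (fun _ y =>
    Complex.exp (↑(t * F (pt z y)) * Complex.I) * ∏ j, (window H (y j) : ℂ)), smul_eq_mul, norm_mul,
    mul_pow, hr2, norm_prod, Finset.prod_pow]
  rfl

open Classical in
/-- If each coordinate of one sample is bad with probability at most `1 / 3`, then among `2 s`
independent samples every coordinate is bad less than `s` times, except with probability at most
`n (8 / 9) ^ s`. -/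
theorem le_sum_prod_of_forall_few_bad {Y : Type} [Fintype Y] (s : ℕ) (q : Y → ℝ)
    (hq0 : ∀ y, 0 ≤ q y) (hq1 : ∑ y, q y = 1) (bad : Fin n → Y → Prop)
    (hbad : ∀ c, ∑ y, (if bad c y then q y else 0) ≤ 1 / 3) (G : (Fin (2 * s) → Y) → Prop)
    (hG : ∀ h, (∀ c, (Finset.univ.filter fun i => bad c (h i)).card < s) → G h) :
    1 - n * (8 / 9 : ℝ) ^ s ≤ ∑ h, if G h then ∏ i, q (h i) else 0 := by
  have hone : ∑ h : Fin (2 * s) → Y, ∏ i, q (h i) = 1 := by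
    rw [← Fintype.piFinset_univ, ← Finset.prod_univ_sum (fun _ => Finset.univ) (fun _ y => q y)]
    simp [hq1]
  have hc : ∀ c, ∑ h : Fin (2 * s) → Y, (if s ≤ (Finset.univ.filter fun i => bad c (h i)).card
      then ∏ i, q (h i) else 0) ≤ (8 / 9 : ℝ) ^ s := fun c => by
    refine (sum_prod_many_bad_le (2 * s) s q hq0 hq1 (bad c) (1 / 3) (hbad c)).trans (le_of_eq ?_)
    -- The base is `(1 + 1 / 3) ^ 2 / 2 = 8 / 9`.
    rw [pow_mul, ← div_pow]
    norm_num
  have hle : ∑ h : Fin (2 * s) → Y, ∏ i, q (h i) ≤ ∑ h : Fin (2 * s) → Y,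
      ((if G h then ∏ i, q (h i) else 0) +
      ∑ c, (if s ≤ (Finset.univ.filter fun i => bad c (h i)).card then ∏ i, q (h i) else 0)) := by
    refine Finset.sum_le_sum fun h _ => ?_
    have h0 : 0 ≤ ∏ i, q (h i) := Finset.prod_nonneg fun i _ => hq0 _
    have hnn : ∀ c, 0 ≤ (if s ≤ (Finset.univ.filter fun i => bad c (h i)).card
        then ∏ i, q (h i) else 0) := fun c => by split_ifs <;> simp [h0]
    by_cases hh : ∀ c, (Finset.univ.filter fun i => bad c (h i)).card < s
    · rw [if_pos (hG h hh)]
      exact le_add_of_nonneg_right (Finset.sum_nonneg fun c _ => hnn c)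
    · push Not at hh
      obtain ⟨c, hc⟩ := hh
      have h1 := Finset.single_le_sum (fun c _ => hnn c) (Finset.mem_univ c)
      rw [if_pos hc] at h1
      refine h1.trans (le_add_of_nonneg_left ?_)
      split_ifs <;> simp [h0]
  rw [hone, Finset.sum_add_distrib, Finset.sum_comm] at hle
  have := Finset.sum_le_sum fun c (_ : c ∈ (Finset.univ : Finset (Fin n))) => hc c
  simp only [Finset.sum_const, Finset.card_univ, Fintype.card_fin, nsmul_eq_mul] at this
  linarith

/-- A Markov argument: if the nonnegative quantities `N z` have small average, and the success
probability given `z` is large whenever `N z` is small, then the total success probability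
is large. -/
theorem one_sub_le_average {Z : Type} [Fintype Z] [Nonempty Z] (N p : Z → ℝ) {κ ρ : ℝ} (hκ : 0 < κ)
    (hρ : ρ ≤ 1) (hN0 : ∀ z, 0 ≤ N z) (hN : ∑ z, N z ≤ ρ / 2 * κ * Fintype.card Z)
    (hp0 : ∀ z, 0 ≤ p z) (hp : ∀ z, N z ≤ κ → 1 - ρ / 2 ≤ p z) :
    1 - ρ ≤ ∑ z, (Fintype.card Z : ℝ)⁻¹ * p z := by
  have hcard : (0 : ℝ) < Fintype.card Z := by exact_mod_cast Fintype.card_pos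
  -- Markov's inequality in pointwise form; the left side is nonpositive at bad centres. Averaging
  -- gives `(1 - ρ / 2) ^ 2 ≥ 1 - ρ`.
  have hz : ∀ z, (1 - ρ / 2) * (1 - N z / κ) ≤ p z := fun z => by
    by_cases h : N z ≤ κ
    · refine le_trans ?_ (hp z h)
      have : 0 ≤ N z / κ := div_nonneg (hN0 z) hκ.le
      nlinarith
    · have : 1 ≤ N z / κ := by rw [one_le_div hκ]; linarith
      refine le_trans ?_ (hp0 z)
      nlinarith
  have hsum : ∑ z, (1 - ρ / 2) * (1 - N z / κ) ≤ ∑ z, p z := Finset.sum_le_sum fun z _ => hz z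
  rw [← Finset.mul_sum, Finset.sum_sub_distrib, ← Finset.sum_div] at hsum
  simp only [Finset.sum_const, Finset.card_univ, nsmul_eq_mul, mul_one] at hsum
  have h1 : (∑ z, N z) / κ ≤ ρ / 2 * Fintype.card Z := by
    rw [div_le_iff₀ hκ]; linarith
  have h2 : (1 - ρ) * Fintype.card Z ≤ ∑ z, p z := by
    nlinarith [mul_le_mul_of_nonneg_left h1 (show 0 ≤ 1 - ρ / 2 by linarith),
      mul_nonneg (sq_nonneg ρ) hcard.le]
  rw [← Finset.mul_sum, le_inv_mul_iff₀ hcard]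
  linarith

open Classical in
/-- `v` is compatible with the majority of the `2 s` measured values in one coordinate. -/
def IsMajoritySlope (H s : ℕ) (τ L : ℝ) (h : Fin (2 * s) → Fin (2 * H + 1)) (v : ℝ) : Prop :=
  |v| ≤ L ∧ (Finset.univ.filter fun i => 8 / (H : ℝ) ≤
    ‖rootOfUnity (2 * H + 1) ^ (h i : ℕ) - Complex.exp (↑(τ * v) * Complex.I)‖).card < s

/-- Each slope disagrees with fewer than half of the samples, so some sample is close to both. The
condition `τ * L ≤ 1` keeps the two phases within `2 < π`, which excludes wrap-around. -/
theorem IsMajoritySlope.abs_sub_le {s : ℕ} {τ L : ℝ} {h : Fin (2 * s) → Fin (2 * H + 1)}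
    {v v' : ℝ} (hv : IsMajoritySlope H s τ L h v) (hv' : IsMajoritySlope H s τ L h v')
    (hτ : 0 < τ) (hτL : τ * L ≤ 1) : |v - v'| ≤ 8 * Real.pi / (τ * H) := by
  classical
  set S := fun v : ℝ => (Finset.univ.filter fun i => 8 / (H : ℝ) ≤
    ‖rootOfUnity (2 * H + 1) ^ (h i : ℕ) - Complex.exp (↑(τ * v) * Complex.I)‖) with hS
  have hlt : (S v ∪ S v').card < (Finset.univ : Finset (Fin (2 * s))).card := by
    have h1 := Finset.card_union_le (S v) (S v')
    have h2 : (S v).card < s := hv.2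
    have h3 : (S v').card < s := hv'.2
    rw [Finset.card_univ, Fintype.card_fin]
    omega
  obtain ⟨i, -, hi⟩ := Finset.exists_mem_notMem_of_card_lt_card hlt
  simp only [hS, Finset.mem_union, Finset.mem_filter, Finset.mem_univ, true_and, not_or,
    not_le] at hi
  have hpi := Real.pi_gt_three
  have hclose : ‖Complex.exp (↑(τ * v) * Complex.I) - Complex.exp (↑(τ * v') * Complex.I)‖ ≤
      16 / H := by
    have := norm_sub_le_norm_sub_add_norm_sub (Complex.exp (↑(τ * v) * Complex.I))
      (rootOfUnity (2 * H + 1) ^ (h i : ℕ)) (Complex.exp (↑(τ * v') * Complex.I))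
    rw [norm_sub_rev (Complex.exp (↑(τ * v) * Complex.I)) (rootOfUnity _ ^ _)] at this
    have e : (16 : ℝ) / H = 8 / H + 8 / H := by ring
    linarith [hi.1, hi.2]
  have habs : |τ * v - τ * v'| = τ * |v - v'| := by rw [← mul_sub, abs_mul, abs_of_pos hτ]
  have hsmall : |τ * v - τ * v'| ≤ Real.pi := by
    rw [habs]
    have : |v - v'| ≤ L + L := (abs_sub v v').trans (add_le_add hv.1 hv'.1)
    nlinarith
  have h1 := abs_sub_le_norm_exp_mul_I_sub_exp_mul_I hsmall
  rw [habs] at h1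
  have h2 : τ * |v - v'| ≤ 8 * Real.pi / H :=
    h1.trans ((mul_le_mul_of_nonneg_left hclose (by positivity)).trans (le_of_eq (by ring)))
  rw [← div_div, div_right_comm, le_div_iff₀ hτ]
  linarith

open Classical in
/-- The output rule: in every coordinate, some slope compatible with the majority. -/
noncomputable def majoritySlope (n H s : ℕ) (τ L : ℝ) (h : Fin (2 * s) → Fin n → Fin (2 * H + 1)) :
    EuclideanSpace ℝ (Fin n) :=
  WithLp.toLp 2 fun c =>
    if hv : ∃ v, IsMajoritySlope H s τ L (fun i => h i c) v then hv.choose else 0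

/-- The slope `v` is itself a witness, so the default value `0` is not used and the chosen slope is
close to `v`. -/
theorem abs_majoritySlope_sub_le {s : ℕ} {τ L : ℝ} {h : Fin (2 * s) → Fin n → Fin (2 * H + 1)}
    {c : Fin n} {v : ℝ} (hv : IsMajoritySlope H s τ L (fun i => h i c) v)
    (hτ : 0 < τ) (hτL : τ * L ≤ 1) :
    |majoritySlope n H s τ L h c - v| ≤ 8 * Real.pi / (τ * H) := by
  have hex : ∃ v, IsMajoritySlope H s τ L (fun i => h i c) v := ⟨v, hv⟩
  have : majoritySlope n H s τ L h c = hex.choose := by simp [majoritySlope, hex]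
  rw [this]
  exact hex.choose_spec.abs_sub_le hv hτ hτL

end Sampling

/-! ### Geometry of the grid and nonlinearity of convex functions. -/

section Lattice

variable {n : ℕ}

theorem EuclideanSpace.norm_le_of_forall_abs_le {x : EuclideanSpace ℝ (Fin n)} {B : ℝ} (hB : 0 ≤ B)
    (h : ∀ i, |x i| ≤ B) : ‖x‖ ≤ √n * B := by
  rw [EuclideanSpace.norm_eq]
  refine Real.sqrt_le_iff.2 ⟨by positivity, ?_⟩
  rw [mul_pow, Real.sq_sqrt (by positivity)]
  calc ∑ i, ‖x i‖ ^ 2 ≤ ∑ _i : Fin n, B ^ 2 :=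
        Finset.sum_le_sum fun i _ => by gcongr; exact h i
    _ = n * B ^ 2 := by simp

theorem EuclideanSpace.sum_abs_le (x : EuclideanSpace ℝ (Fin n)) : ∑ i, |x i| ≤ √n * ‖x‖ := by
  rw [EuclideanSpace.norm_eq, ← Real.sqrt_mul (by positivity)]
  refine Real.le_sqrt_of_sq_le ?_
  have := sq_sum_le_card_mul_sum_sq (s := Finset.univ) (f := fun i => |x i|)
  simpa using this

theorem isOpen_setOf_abs_lt (s : ℝ) :
    IsOpen {x : EuclideanSpace ℝ (Fin n) | ∀ i, |x i| < s} := by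
  simp only [Set.ofPred_forall]
  exact isOpen_iInter_of_finite fun i => isOpen_lt (by fun_prop) continuous_const

theorem convex_setOf_abs_lt (s : ℝ) :
    Convex ℝ {x : EuclideanSpace ℝ (Fin n) | ∀ i, |x i| < s} := by
  simp only [Set.ofPred_forall, abs_lt]
  exact convex_iInter fun i => (convex_Ioo (-s) s).linear_preimage
    (EuclideanSpace.proj i : EuclideanSpace ℝ (Fin n) →L[ℝ] ℝ).toLinearMap

theorem abs_sub_le_of_lipschitzOnWith {E : Type*} [SeminormedAddCommGroup E] {f : E → ℝ}
    {L : ℝ} (hL : 0 ≤ L) {S : Set E} (hf : LipschitzOnWith L.toNNReal f S) {x y : E} (hx : x ∈ S)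
    (hy : y ∈ S) : |f x - f y| ≤ L * ‖x - y‖ := by
  have := hf.dist_le_mul x hx y hy
  rwa [Real.dist_eq, dist_eq_norm, Real.coe_toNNReal L hL] at this

/-- A convex function that is Lipschitz on a cube has, at each point of the half-size cube,
a subgradient whose coordinates are bounded by the Lipschitz constant. -/
theorem ConvexOn.exists_subgradient_supBall {C : Set (EuclideanSpace ℝ (Fin n))}
    {f : EuclideanSpace ℝ (Fin n) → ℝ} {r L : ℝ} (hf : ConvexOn ℝ C f) (hr : 0 < r) (hL : 0 ≤ L)
    (hC : supBall n (2 * r) ⊆ C) (hLip : LipschitzOnWith L.toNNReal f (supBall n (2 * r)))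
    {x : EuclideanSpace ℝ (Fin n)} (hx : x ∈ supBall n r) :
    ∃ g : EuclideanSpace ℝ (Fin n), (∀ c, |g c| ≤ L) ∧
      ∀ y ∈ C, f x + inner ℝ g (y - x) ≤ f y := by
  set B := {x : EuclideanSpace ℝ (Fin n) | ∀ i, |x i| < 2 * r}
  have hBs : B ⊆ supBall n (2 * r) := fun y hy i => (hy i).le
  have hxB : x ∈ B := fun i => (hx i).trans_lt (by linarith)
  obtain ⟨g, hg⟩ := hf.exists_subgradient (isOpen_setOf_abs_lt _) (convex_setOf_abs_lt _)
    (hBs.trans hC) (hLip.continuousOn.mono hBs) hxB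
  refine ⟨g, fun c => ?_, hg⟩
  -- From a point of the half-size cube, a step of length `r` along a coordinate axis stays in the
  -- cube where `f` is Lipschitz.
  have key : ∀ s : ℝ, |s| = r → s * g c ≤ L * r := fun s hs => by
    have hmem : x + EuclideanSpace.single c s ∈ supBall n (2 * r) := fun i => by
      have h1 : |EuclideanSpace.single c s i| ≤ r := by
        rw [PiLp.single_apply]
        split_ifs
        · exact hs.le
        · simpa using hr.le
      have h2 := abs_add_le (x i) (EuclideanSpace.single c s i)
      have h3 := hx i
      rw [PiLp.add_apply]
      linarith
    have h1 := hg _ (hC hmem)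
    have h2 := abs_sub_le_of_lipschitzOnWith hL hLip hmem (hBs hxB)
    rw [add_sub_cancel_left] at h1 h2
    rw [EuclideanSpace.inner_single_right] at h1
    simp only [conj_trivial] at h1
    rw [PiLp.norm_single, Real.norm_eq_abs, hs] at h2
    linarith [le_abs_self (f (x + EuclideanSpace.single c s) - f x)]
  rw [abs_le]
  have h1 := key r (abs_of_pos hr)
  have h2 := key (-r) (by rw [abs_neg, abs_of_pos hr])
  constructor <;> nlinarith

/-- A vector close to a subgradient at a point near `0` gives an affine lower bound. -/
theorem affine_lower_bound {C : Set (EuclideanSpace ℝ (Fin n))}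
    {f : EuclideanSpace ℝ (Fin n) → ℝ} {r L ε : ℝ} (hr : 0 < r) (hL : 0 ≤ L)
    (hC : supBall n (2 * r) ⊆ C) (hLip : LipschitzOnWith L.toNNReal f (supBall n (2 * r)))
    {x g g' : EuclideanSpace ℝ (Fin n)} (hx : x ∈ supBall n r)
    (hg : ∀ y ∈ C, f x + inner ℝ g (y - x) ≤ f y) (hg' : ∀ c, |g' c - g c| ≤ ε)
    {y : EuclideanSpace ℝ (Fin n)} (hy : y ∈ C) :
    f 0 + inner ℝ g' y - ε * ∑ i, |y i| - 2 * L * √n * r ≤ f y := by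
  have h0 : (0 : EuclideanSpace ℝ (Fin n)) ∈ supBall n (2 * r) := fun i => by simp [hr.le]
  have hx2 : x ∈ supBall n (2 * r) := fun i => (hx i).trans (by linarith)
  -- Testing the subgradient at `2 x` gives `⟪g, x⟫ ≤ f (2 x) - f x ≤ L ‖x‖`, so no bound on `‖g‖`
  -- is needed.
  have h2x : (2 : ℝ) • x ∈ supBall n (2 * r) := fun i => by
    rw [PiLp.smul_apply, smul_eq_mul, abs_mul, abs_two]
    linarith [hx i]
  have hnorm := EuclideanSpace.norm_le_of_forall_abs_le hr.le hx
  have h1 := abs_sub_le_of_lipschitzOnWith hL hLip h0 hx2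
  have h2 := abs_sub_le_of_lipschitzOnWith hL hLip h2x hx2
  have h3 := hg _ (hC h2x)
  rw [zero_sub, norm_neg] at h1
  have e : (2 : ℝ) • x - x = x := by module
  rw [e] at h2 h3
  have h4 := hg y hy
  rw [inner_sub_right] at h4
  have h5 : inner ℝ g' y - inner ℝ g y ≤ ε * ∑ i, |y i| := by
    rw [← inner_sub_left, PiLp.inner_apply, Finset.mul_sum]
    refine Finset.sum_le_sum fun i _ => ?_
    calc inner ℝ ((g' - g) i) (y i) = (g' i - g i) * y i := by simp [mul_comm]
      _ ≤ |(g' i - g i) * y i| := le_abs_self _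
      _ = |g' i - g i| * |y i| := abs_mul _ _
      _ ≤ _ := by gcongr; exact hg' i
  have h6 : L * ‖x‖ ≤ L * (√n * r) := by gcongr
  linarith [le_abs_self (f 0 - f x), le_abs_self (f ((2 : ℝ) • x) - f x)]

/-- The point with integer coordinates `x` of the lattice extending the grid `4 r G_{l + 2}^n`. -/
noncomputable def latticePoint (r : ℝ) (l : ℕ) (x : Fin n → ℤ) : EuclideanSpace ℝ (Fin n) :=
  WithLp.toLp 2 fun c => r / 2 ^ l * ((x c : ℝ) + 1 / 2) - 2 * r

theorem latticePoint_apply (r : ℝ) (l : ℕ) (x : Fin n → ℤ) (c : Fin n) :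
    latticePoint r l x c = r / 2 ^ l * ((x c : ℝ) + 1 / 2) - 2 * r := rfl

/-- The grid index of a lattice point. -/
def gridIndex (l : ℕ) (x : Fin n → ℤ) (c : Fin n) : Fin (2 ^ (l + 2)) :=
  ⟨(x c).toNat % 2 ^ (l + 2), Nat.mod_lt _ (by positivity)⟩

/-- In this range the reduction modulo `2 ^ (l + 2)` does nothing, and the grid spacing is `4 r / 2
^ (l + 2) = r / 2 ^ l`. -/
theorem gridPoint_gridIndex (r : ℝ) (l : ℕ) {x : Fin n → ℤ} (h0 : ∀ c, 0 ≤ x c)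
    (h1 : ∀ c, x c < 4 * 2 ^ l) :
    gridPoint n (l + 2) (2 * r) (gridIndex l x) = latticePoint r l x := by
  ext c
  have hv : (((gridIndex l x c : ℕ) : ℤ)) = x c := by
    have h2 : (x c).toNat < 2 ^ (l + 2) := by
      have := h1 c
      rw [Int.toNat_lt (h0 c), pow_add]
      push_cast
      linarith
    simp only [gridIndex]
    rw [Nat.mod_eq_of_lt h2, Int.toNat_of_nonneg (h0 c)]
  have hv' : ((gridIndex l x c : ℕ) : ℝ) = x c := by exact_mod_cast congrArg (Int.cast (R := ℝ)) hv
  rw [latticePoint_apply]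
  simp only [gridPoint, gridCoord, hv']
  field_simp
  ring

theorem latticePoint_mem_supBall {r : ℝ} (hr : 0 < r) (l : ℕ) {x : Fin n → ℤ}
    (h0 : ∀ c, 0 ≤ x c) (h1 : ∀ c, x c < 4 * 2 ^ l) : latticePoint r l x ∈ supBall n (2 * r) := by
  intro c
  have h0' : (0 : ℝ) ≤ x c := by exact_mod_cast h0 c
  have h1' : (x c : ℝ) + 1 ≤ 4 * 2 ^ l := by exact_mod_cast h1 c
  rw [latticePoint_apply, abs_le]
  have hp : (0 : ℝ) < r / 2 ^ l := by positivity
  have e : r / 2 ^ l * 2 ^ l = r := by field_simp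
  constructor <;> nlinarith

/-- The integer box indexing the grid points in the half-size cube. -/
noncomputable abbrev centreBox (n l : ℕ) : Finset (Fin n → ℤ) :=
  Fintype.piFinset fun _ : Fin n => Finset.Ico (2 ^ l : ℤ) (2 ^ l + (2 * 2 ^ l : ℕ))

theorem mem_centreBox {l : ℕ} {x : Fin n → ℤ} :
    x ∈ centreBox n l ↔ ∀ c, 2 ^ l ≤ x c ∧ x c < 3 * 2 ^ l := by
  simp only [centreBox, Fintype.mem_piFinset, Finset.mem_Ico]
  push_cast
  refine forall_congr' fun c => and_congr_right fun _ => ?_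
  rw [show (2 ^ l + 2 * 2 ^ l : ℤ) = 3 * 2 ^ l by ring]

theorem latticePoint_mem_supBall_of_mem_centreBox {r : ℝ} (hr : 0 < r) {l : ℕ} {x : Fin n → ℤ}
    (hx : x ∈ centreBox n l) : latticePoint r l x ∈ supBall n r := by
  intro c
  have h := mem_centreBox.1 hx c
  have h0' : (2 ^ l : ℝ) ≤ x c := by exact_mod_cast h.1
  have h1' : (x c : ℝ) + 1 ≤ 3 * 2 ^ l := by exact_mod_cast h.2
  rw [latticePoint_apply, abs_le]
  have hp : (0 : ℝ) < r / 2 ^ l := by positivity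
  have e : r / 2 ^ l * 2 ^ l = r := by field_simp
  constructor <;> nlinarith

theorem add_bounds_of_mem_centreBox {l H : ℕ} (hH : H ≤ 2 ^ l) {x ν : Fin n → ℤ}
    (hx : x ∈ centreBox n l) (hν : ∀ c, |ν c| ≤ H) :
    (∀ c, 0 ≤ (x + ν) c) ∧ ∀ c, (x + ν) c < 4 * 2 ^ l := by
  have hH' : (H : ℤ) ≤ 2 ^ l := by exact_mod_cast hH
  rw [mem_centreBox] at hx
  refine ⟨fun c => ?_, fun c => ?_⟩ <;>
  · have h1 := hx c
    have h2 := abs_le.1 (hν c)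
    rw [Pi.add_apply]
    linarith

theorem latticePoint_add_sub (r : ℝ) (l : ℕ) (x ν : Fin n → ℤ) (c : Fin n) :
    (latticePoint r l (x + ν) - latticePoint r l x) c = r / 2 ^ l * ν c := by
  rw [PiLp.sub_apply, latticePoint_apply, latticePoint_apply, Pi.add_apply]
  push_cast
  ring

/-- The margin around `centreBox` has width `2 ^ l ≥ H`, so both points lie in the Lipschitz cube.
The factor `√n` is weakened to `n`, which the later choice of scale can afford. -/
theorem abs_sub_latticePoint_le {f : EuclideanSpace ℝ (Fin n) → ℝ} {r L : ℝ} (hr : 0 < r)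
    (hL : 0 ≤ L) (hLip : LipschitzOnWith L.toNNReal f (supBall n (2 * r))) {l H : ℕ}
    (hH : H ≤ 2 ^ l) {x ν : Fin n → ℤ} (hν : ∀ c, |ν c| ≤ H)
    (hx : x ∈ centreBox n l ∨ x + ν ∈ centreBox n l) :
    |f (latticePoint r l (x + ν)) - f (latticePoint r l x)| ≤ L * (n * (r / 2 ^ l * H)) := by
  have hmem : ∀ x, x ∈ centreBox n l → latticePoint r l x ∈ supBall n (2 * r) := fun x hx i =>
    (latticePoint_mem_supBall_of_mem_centreBox hr hx i).trans (by linarith)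
  have hmem' : ∀ x ν : Fin n → ℤ, (∀ c, |ν c| ≤ H) → x ∈ centreBox n l →
      latticePoint r l (x + ν) ∈ supBall n (2 * r) := fun x ν hν hx =>
    latticePoint_mem_supBall hr l (add_bounds_of_mem_centreBox hH hx hν).1
      (add_bounds_of_mem_centreBox hH hx hν).2
  have h1 : latticePoint r l (x + ν) ∈ supBall n (2 * r) := by
    rcases hx with hx | hx
    · exact hmem' x ν hν hx
    · exact hmem _ hx
  have h2 : latticePoint r l x ∈ supBall n (2 * r) := by
    rcases hx with hx | hx
    · exact hmem _ hx
    · have := hmem' (x + ν) (-ν) (fun c => by simpa using hν c) hx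
      rwa [add_neg_cancel_right] at this
  refine (abs_sub_le_of_lipschitzOnWith hL hLip h1 h2).trans ?_
  gcongr
  refine (EuclideanSpace.norm_le_of_forall_abs_le (B := r / 2 ^ l * H) (by positivity)
    fun c => ?_).trans ?_
  · rw [latticePoint_add_sub, abs_mul, abs_of_pos (by positivity)]
    gcongr
    calc |(ν c : ℝ)| = ((|ν c| : ℤ) : ℝ) := Int.cast_abs.symm
      _ ≤ ((H : ℤ) : ℝ) := Int.cast_le.2 (hν c)
      _ = H := Int.cast_natCast H
  · gcongr
    refine Real.sqrt_le_iff.2 ⟨by positivity, ?_⟩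
    exact_mod_cast Nat.le_self_pow two_ne_zero n

/-- The integer offset encoded by the label `y`. -/
def labelOffset {H : ℕ} (y : Fin n → Fin (2 * H + 1)) (c : Fin n) : ℤ := (y c : ℤ) - H

theorem abs_labelOffset_le {H : ℕ} (y : Fin n → Fin (2 * H + 1)) (c : Fin n) :
    |labelOffset y c| ≤ H := by
  have := (y c).2
  rw [labelOffset, abs_le]
  omega

/-- Reflection of labels. -/
def labelRev (n H : ℕ) : (Fin n → Fin (2 * H + 1)) ≃ (Fin n → Fin (2 * H + 1)) :=
  Equiv.piCongrRight fun _ => Fin.revPerm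

theorem labelOffset_labelRev {H : ℕ} (y : Fin n → Fin (2 * H + 1)) :
    labelOffset (labelRev n H y) = -labelOffset y := by
  ext c
  have := (y c).2
  simp only [labelOffset, labelRev, Equiv.piCongrRight_apply, Pi.map_apply, Fin.revPerm_apply,
    Fin.val_rev, Pi.neg_apply]
  omega

/-- The squared amplitude of a label in the windowed state. -/
noncomputable def labelWeight {H : ℕ} (y : Fin n → Fin (2 * H + 1)) : ℝ :=
  ∏ i, window H (y i) ^ 2

theorem labelWeight_nonneg {H : ℕ} (y : Fin n → Fin (2 * H + 1)) : 0 ≤ labelWeight y :=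
  Finset.prod_nonneg fun _ _ => sq_nonneg _

theorem labelWeight_labelRev {H : ℕ} (y : Fin n → Fin (2 * H + 1)) :
    labelWeight (labelRev n H y) = labelWeight y :=
  Finset.prod_congr rfl fun i _ => by
    rw [show (labelRev n H y i) = (y i).rev from rfl, window_rev]

theorem sum_labelWeight_mul_labelOffset {H : ℕ} (c : Fin n) :
    ∑ y : Fin n → Fin (2 * H + 1), labelWeight y * labelOffset y c = 0 := by
  have h := Equiv.sum_comp (labelRev n H)
    fun y : Fin n → Fin (2 * H + 1) => labelWeight y * (labelOffset y c : ℝ)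
  simp only [labelWeight_labelRev, labelOffset_labelRev, Pi.neg_apply, Int.cast_neg, mul_neg,
    Finset.sum_neg_distrib] at h
  linarith

/-- The average deviation of `f` from its linearisation around the lattice point `z`. -/
noncomputable def nonlinearity (f : EuclideanSpace ℝ (Fin n) → ℝ) (r : ℝ) (l H : ℕ)
    (z : Fin n → ℤ) : ℝ :=
  ∑ y : Fin n → Fin (2 * H + 1), labelWeight y *
    (f (latticePoint r l (z + labelOffset y)) - f (latticePoint r l z))

/-- The subgradient inequality makes every deviation nonnegative, so the absolute values drop; the
linear term has mean zero because the weights are symmetric. The right side no longer involves `g`.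
-/
theorem sum_abs_sub_linear_eq_nonlinearity {C : Set (EuclideanSpace ℝ (Fin n))}
    {f : EuclideanSpace ℝ (Fin n) → ℝ} {r : ℝ} (hr : 0 < r)
    (hC : supBall n (2 * r) ⊆ C) {l H : ℕ} (hH : H ≤ 2 ^ l) {z : Fin n → ℤ}
    (hz : z ∈ centreBox n l) {g : EuclideanSpace ℝ (Fin n)}
    (hg : ∀ y ∈ C, f (latticePoint r l z) + inner ℝ g (y - latticePoint r l z) ≤ f y) :
    ∑ y : Fin n → Fin (2 * H + 1), labelWeight y *
      |f (latticePoint r l (z + labelOffset y)) -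
        (f (latticePoint r l z) + ∑ c, r / 2 ^ l * g c * labelOffset y c)| =
      nonlinearity f r l H z := by
  have hin : ∀ y : Fin n → Fin (2 * H + 1),
      inner ℝ g (latticePoint r l (z + labelOffset y) - latticePoint r l z) =
      ∑ c, r / 2 ^ l * g c * labelOffset y c := fun y => by
    rw [PiLp.inner_apply]
    refine Finset.sum_congr rfl fun c _ => ?_
    rw [latticePoint_add_sub]
    simp only [inner]
    simp
    ring
  have habs : ∀ y : Fin n → Fin (2 * H + 1), |f (latticePoint r l (z + labelOffset y)) -
        (f (latticePoint r l z) + ∑ c, r / 2 ^ l * g c * labelOffset y c)| =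
      (f (latticePoint r l (z + labelOffset y)) - f (latticePoint r l z)) -
        ∑ c, r / 2 ^ l * g c * labelOffset y c := fun y => by
    have hb := add_bounds_of_mem_centreBox hH hz (abs_labelOffset_le y)
    have := hg _ (hC (latticePoint_mem_supBall hr l hb.1 hb.2))
    rw [hin] at this
    rw [abs_of_nonneg (by linarith)]
    ring
  have hzero : ∑ y : Fin n → Fin (2 * H + 1), labelWeight y *
      ∑ c, r / 2 ^ l * g c * labelOffset y c = 0 := by
    simp only [Finset.mul_sum]
    rw [Finset.sum_comm]
    refine Finset.sum_eq_zero fun c _ => ?_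
    rw [← mul_zero (r / 2 ^ l * g c), ← sum_labelWeight_mul_labelOffset (H := H) c, Finset.mul_sum]
    exact Finset.sum_congr rfl fun y _ => by ring
  simp only [habs, mul_sub _ (_ - _), Finset.sum_sub_distrib]
  rw [hzero, sub_zero, nonlinearity]

theorem card_centreBox (n l : ℕ) : (centreBox n l).card = (2 * 2 ^ l) ^ n := by
  simp only [centreBox, Fintype.card_piFinset, Int.card_Ico, add_sub_cancel_left,
    Int.toNat_natCast, Finset.prod_const, Finset.card_univ, Fintype.card_fin]

/-- The bound is quadratic in the side `r / 2 ^ l * H`: one factor is the Lipschitz increment, the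
other the fraction of centres near the boundary of the box. -/
theorem sum_nonlinearity_le {f : EuclideanSpace ℝ (Fin n) → ℝ} {r L : ℝ} (hr : 0 < r)
    (hL : 0 ≤ L) (hLip : LipschitzOnWith L.toNNReal f (supBall n (2 * r))) {l H : ℕ}
    (hH0 : 0 < H) (hH : H ≤ 2 ^ l) :
    ∑ z ∈ centreBox n l, nonlinearity f r l H z ≤
      n ^ 2 * L * (r / 2 ^ l * H) ^ 2 / (2 * r) * (centreBox n l).card := by
  have h := sum_box_sum_symmetric_shift_le (n := n) (2 ^ l) (2 * 2 ^ l) H labelOffset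
    abs_labelOffset_le labelWeight labelWeight_nonneg (sum_prod_window_sq n hH0) (labelRev n H)
    labelWeight_labelRev labelOffset_labelRev (fun x => f (latticePoint r l x))
    (L * (n * (r / 2 ^ l * H))) (by positivity)
    fun y x hx => abs_sub_latticePoint_le hr hL hLip hH (abs_labelOffset_le y) hx
  have h' : ((2 * 2 ^ l : ℕ) : ℝ) * ∑ z ∈ centreBox n l, nonlinearity f r l H z ≤
      n * H * ((2 * 2 ^ l : ℕ) : ℝ) ^ n * (L * (n * (r / 2 ^ l * H))) := h
  rw [card_centreBox]
  push_cast at h' ⊢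
  have hp : (0 : ℝ) < 2 * 2 ^ l := by positivity
  rw [← le_div_iff₀' hp] at h'
  refine h'.trans (le_of_eq ?_)
  field_simp

end Lattice

/-! ### Choice of parameters and assembly. -/

/-- A number of repetitions that is logarithmic in `n / ρ` suffices for the union bound. -/
theorem exists_rounds : ∃ K : ℝ, ∀ (n : ℕ) (ρ : ℝ), 0 < n → 0 < ρ → ρ ≤ 1 / 3 →
    ∃ s : ℕ, 2 * (2 * s : ℝ) ≤ K * Real.log (n / ρ) ∧ n * (8 / 9 : ℝ) ^ s ≤ ρ / 2 := by
  set c := Real.log (9 / 8) with hc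
  have hc0 : 0 < c := Real.log_pos (by norm_num)
  refine ⟨4 * (2 / c + 1), fun n ρ hn hρ hρ3 => ?_⟩
  have hn1 : (1 : ℝ) ≤ n := by exact_mod_cast hn
  -- Since `3 > e`, the logarithm is at least `1` and absorbs both the factor `2` and the rounding
  -- up.
  have h3 : 3 ≤ n / ρ := by rw [le_div_iff₀ hρ]; linarith
  have hpos : 0 < n / ρ := by linarith
  have hlog1 : 1 ≤ Real.log (n / ρ) := by
    rw [Real.le_log_iff_exp_le hpos]
    linarith [Real.exp_one_lt_d9]
  have hlog2 : Real.log (2 * (n / ρ)) ≤ 2 * Real.log (n / ρ) := by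
    rw [Real.log_mul (by norm_num) hpos.ne', two_mul]
    gcongr
    linarith
  refine ⟨⌈Real.log (2 * (n / ρ)) / c⌉₊, ?_, ?_⟩
  · have h1 := (Nat.ceil_lt_add_one (a := Real.log (2 * (n / ρ)) / c)
      (div_nonneg (Real.log_nonneg (by linarith)) hc0.le)).le
    have h2 : Real.log (2 * (n / ρ)) / c ≤ 2 / c * Real.log (n / ρ) := by
      rw [div_mul_eq_mul_div]; gcongr
    linarith
  · have h1 := Nat.le_ceil (Real.log (2 * (n / ρ)) / c)
    set s := ⌈Real.log (2 * (n / ρ)) / c⌉₊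
    rw [div_le_iff₀ hc0] at h1
    have h2 : 2 * (n / ρ) ≤ (9 / 8 : ℝ) ^ s := by
      rw [← Real.log_le_log_iff (by positivity) (by positivity), Real.log_pow]
      exact h1
    have h4 : (8 / 9 : ℝ) ^ s = ((9 / 8 : ℝ) ^ s)⁻¹ := by rw [← inv_pow]; norm_num
    rw [h4, ← div_eq_mul_inv, div_le_iff₀ (by positivity)]
    calc (n : ℝ) = ρ / 2 * (2 * (n / ρ)) := by field_simp
      _ ≤ _ := by gcongr

/-- The choice of the side length of the sampled subcube, of the phase scale and of the grid. -/
theorem exists_scale {n : ℕ} {r L ρ δ : ℝ} (hn : 0 < n) (hr : 0 < r) (hL : 0 < L) (hρ : 0 < ρ)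
    (hδ : 0 < δ) (hδ' : δ ≤ r * n * L / ρ) :
    ∃ l₀ : ℕ, ∀ l ≥ l₀, ∃ H : ℕ, 0 < H ∧ H ≤ 2 ^ l ∧
      12 / 100 / δ * (r / 2 ^ l) * L ≤ 1 ∧
      8 * Real.pi / (12 / 100 / δ * (r / 2 ^ l) * H) ≤ 23 ^ 2 * √(δ * n ^ 3 * L / (ρ * r)) ∧
      n ^ 2 * L * (r / 2 ^ l * H) ^ 2 / (2 * r) ≤ ρ / 2 * (24 / 100 * δ) := by
  have hn1 : (1 : ℝ) ≤ n := by exact_mod_cast hn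
  have hn0 : (0 : ℝ) < n := by linarith
  -- `R` is the target for `η * H`, where `η` is the grid spacing: small enough for the mean
  -- nonlinearity, large enough for precision. The bound on `δ` ensures `R ≤ r`.
  set R := √(24 / 100 * (δ * (ρ * r) / (n ^ 3 * L))) with hR
  have hR2 : R ^ 2 = 24 / 100 * (δ * (ρ * r) / (n ^ 3 * L)) := Real.sq_sqrt (by positivity)
  have hR0 : 0 < R := Real.sqrt_pos.2 (by positivity)
  have hn3 : (n : ℝ) ≤ n ^ 3 := le_self_pow₀ hn1 (by norm_num)
  have hRr : R ≤ r := by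
    refine Real.sqrt_le_iff.2 ⟨hr.le, ?_⟩
    rw [le_div_iff₀ hρ] at hδ'
    have : δ * (ρ * r) / (n ^ 3 * L) ≤ r ^ 2 := by
      rw [div_le_iff₀ (by positivity)]
      calc δ * (ρ * r) = δ * ρ * r := by ring
        _ ≤ r * n * L * r := by gcongr
        _ = r ^ 2 * (n * L) := by ring
        _ ≤ _ := by gcongr
    nlinarith [sq_nonneg r]
  -- The first entry makes rounding `R / η` down lose at most a tenth; the second prevents phase
  -- wrap-around.
  set q := min (R / (10 * r)) (δ / (12 / 100 * r * L)) with hq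
  have hq0 : 0 < q := lt_min (by positivity) (by positivity)
  obtain ⟨l₀, hl₀⟩ := exists_pow_lt_of_lt_one hq0 (show (1 / 2 : ℝ) < 1 by norm_num)
  refine ⟨l₀, fun l hl => ?_⟩
  have hlq : (1 / 2 : ℝ) ^ l ≤ q :=
    (pow_le_pow_of_le_one (by norm_num) (by norm_num) hl).trans hl₀.le
  have hη : r / 2 ^ l = r * (1 / 2 : ℝ) ^ l := by rw [one_div, inv_pow, div_eq_mul_inv]
  set η := r / 2 ^ l with hηdef
  have hη0 : 0 < η := by positivity
  have hη1 : η ≤ R / 10 := by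
    rw [hη]
    calc r * (1 / 2 : ℝ) ^ l ≤ r * (R / (10 * r)) := by gcongr; exact hlq.trans (min_le_left _ _)
      _ = R / 10 := by field_simp
  have hη2 : η ≤ δ / (12 / 100 * L) := by
    rw [hη]
    calc r * (1 / 2 : ℝ) ^ l ≤ r * (δ / (12 / 100 * r * L)) := by
          gcongr; exact hlq.trans (min_le_right _ _)
      _ = δ / (12 / 100 * L) := by field_simp
  set H := ⌊R / η⌋₊ with hH
  have hHle : η * H ≤ R := by
    have := Nat.floor_le (show 0 ≤ R / η by positivity)
    rw [le_div_iff₀ hη0] at this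
    linarith
  have hHge : 9 / 10 * R ≤ η * H := by
    have := Nat.lt_floor_add_one (R / η)
    rw [div_lt_iff₀ hη0] at this
    linarith
  have hH0 : 0 < H := by
    rcases Nat.eq_zero_or_pos H with h | h
    · rw [h] at hHge; simp at hHge; linarith
    · exact h
  have hH0' : (0 : ℝ) < H := by exact_mod_cast hH0
  refine ⟨H, hH0, ?_, ?_, ?_, ?_⟩
  · have h1 : η * H ≤ η * 2 ^ l := by
      rw [hηdef, div_mul_cancel₀ _ (by positivity : (2 : ℝ) ^ l ≠ 0)]
      exact hHle.trans hRr
    exact_mod_cast le_of_mul_le_mul_left h1 hη0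
  · rw [le_div_iff₀ (by positivity)] at hη2
    rw [div_mul_eq_mul_div, div_mul_eq_mul_div, div_le_one hδ]
    linarith
  · set T := √(δ * n ^ 3 * L / (ρ * r)) with hT
    have hT2 : T ^ 2 = δ * n ^ 3 * L / (ρ * r) := Real.sq_sqrt (by positivity)
    have hT0 : 0 ≤ T := Real.sqrt_nonneg _
    have hTR : 48 / 100 * δ ≤ T * R := by
      refine (pow_le_pow_iff_left₀ (by positivity) (by positivity) two_ne_zero).1 ?_
      rw [mul_pow, mul_pow, hT2, hR2]
      have : δ * n ^ 3 * L / (ρ * r) * (24 / 100 * (δ * (ρ * r) / (n ^ 3 * L))) =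
          24 / 100 * δ ^ 2 := by field_simp
      rw [this]
      nlinarith [sq_nonneg δ]
    rw [div_le_iff₀ (by positivity)]
    have h1 : T * (9 / 10 * R) ≤ T * (η * H) := by gcongr
    have h2 : 43 / 100 * δ ≤ T * (η * H) := by linarith
    -- Here `0.43` is below `0.9 * 0.48`, with `0.48 < √0.24` from `hTR`; the product is about
    -- `27.3`, above `8 π ≈ 25.1`.
    calc 8 * Real.pi ≤ 23 ^ 2 * (12 / 100) * (43 / 100) := by linarith [Real.pi_lt_d2]
      _ = 23 ^ 2 * (12 / 100 / δ) * (43 / 100 * δ) := by field_simp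
      _ ≤ 23 ^ 2 * (12 / 100 / δ) * (T * (η * H)) := by gcongr
      _ = _ := by ring
  · calc n ^ 2 * L * (η * H) ^ 2 / (2 * r) ≤ n ^ 2 * L * R ^ 2 / (2 * r) := by gcongr
      _ = ρ / 2 * (24 / 100 * δ) / n := by rw [hR2]; field_simp
      _ ≤ _ := div_le_self (by positivity) hn1

open Classical in
/-- Around a centre with small nonlinearity the majority slopes satisfy the affine lower bound
with high probability. -/
theorem le_sum_majoritySlope {n l H s : ℕ} {C : Set (EuclideanSpace ℝ (Fin n))}
    {f : EuclideanSpace ℝ (Fin n) → ℝ} {F : (Fin n → Fin (2 ^ (l + 2))) → ℝ} {r L δ ε : ℝ}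
    (hr : 0 < r) (hL : 0 < L) (hδ : 0 < δ) (hf : ConvexOn ℝ C f) (hC : supBall n (2 * r) ⊆ C)
    (hLip : LipschitzOnWith L.toNNReal f (supBall n (2 * r)))
    (hF : ∀ j, |F j - f (gridPoint n (l + 2) (2 * r) j)| ≤ δ)
    (hH0 : 0 < H) (hH : H ≤ 2 ^ l) (hτL : 12 / 100 / δ * (r / 2 ^ l) * L ≤ 1)
    (hε : 8 * Real.pi / (12 / 100 / δ * (r / 2 ^ l) * H) ≤ ε)
    {z : Fin n → ℤ} (hz : z ∈ centreBox n l) (hN : nonlinearity f r l H z ≤ 24 / 100 * δ)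
    (E : Set (EuclideanSpace ℝ (Fin n)))
    (hE : ∀ g, (∀ y ∈ C, f 0 + inner ℝ g y - ε * ∑ i, |y i| - 2 * L * √n * r ≤ f y) → g ∈ E) :
    1 - n * (8 / 9 : ℝ) ^ s ≤ ∑ h : Fin (2 * s) → Fin n → Fin (2 * H + 1),
      if majoritySlope n H s (12 / 100 / δ * (r / 2 ^ l)) L h ∈ E then
        ∏ i, ‖fourierState n H
          (fun y => 12 / 100 / δ * F (gridIndex l (z + labelOffset y))) (h i)‖ ^ 2 else 0 := by
  set t := 12 / 100 / δ with ht
  have ht0 : 0 < t := by positivity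
  set τ := t * (r / 2 ^ l) with hτ
  have hτ0 : 0 < τ := by positivity
  have hx := latticePoint_mem_supBall_of_mem_centreBox hr hz
  -- This `g` serves only the analysis; the output rule does not depend on it.
  obtain ⟨g, hgL, hg⟩ := hf.exists_subgradient_supBall hr hL.le hC hLip hx
  refine le_sum_prod_of_forall_few_bad s (fun y => ‖fourierState n H
    (fun y => t * F (gridIndex l (z + labelOffset y))) y‖ ^ 2) (fun _ => by positivity)
    (sum_norm_sq_fourierState hH0 _) (fun c y => 8 / (H : ℝ) ≤
      ‖rootOfUnity (2 * H + 1) ^ (y c : ℕ) - Complex.exp (↑(τ * g c) * Complex.I)‖) ?_ _ ?_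
  · refine sum_tensorPower_fourierMatrix_far_le hH0 (fun c => τ * g c) (t * f (latticePoint r l z))
      _ (fun y => t * f (latticePoint r l (z + labelOffset y))) (fun y => ?_) ?_
    · have hb := add_bounds_of_mem_centreBox hH hz (abs_labelOffset_le y)
      have := hF (gridIndex l (z + labelOffset y))
      rw [gridPoint_gridIndex r l hb.1 hb.2] at this
      rw [← mul_sub, abs_mul, abs_of_pos ht0]
      calc _ ≤ t * δ := by gcongr
        _ = 12 / 100 := by rw [ht]; field_simp
    · have hsum := sum_abs_sub_linear_eq_nonlinearity (H := H) hr hC hH hz hg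
      have e : ∀ y : Fin n → Fin (2 * H + 1),
          (∏ i, window H (y i) ^ 2) * |t * f (latticePoint r l (z + labelOffset y)) -
          (t * f (latticePoint r l z) + ∑ i, τ * g i * ((y i : ℝ) - H))| =
          t * (labelWeight y * |f (latticePoint r l (z + labelOffset y)) -
        (f (latticePoint r l z) + ∑ c, r / 2 ^ l * g c * labelOffset y c)|) := fun y => by
        have : t * f (latticePoint r l (z + labelOffset y)) -
          (t * f (latticePoint r l z) + ∑ i, τ * g i * ((y i : ℝ) - H)) =
          t * (f (latticePoint r l (z + labelOffset y)) -
          (f (latticePoint r l z) + ∑ c, r / 2 ^ l * g c * labelOffset y c)) := by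
          rw [mul_sub, mul_add, Finset.mul_sum]
          congr 2
          refine Finset.sum_congr rfl fun i _ => ?_
          simp only [hτ, labelOffset]
          push_cast
          ring
        rw [this, abs_mul, abs_of_pos ht0, labelWeight]
        ring
      simp only [e]
      rw [← Finset.mul_sum, hsum]
      calc _ ≤ t * (24 / 100 * δ) := by gcongr
        _ = 288 / 10000 := by rw [ht]; field_simp; norm_num
  · intro h hh
    refine hE _ fun y hy => affine_lower_bound hr hL.le hC hLip hx hg (fun c => ?_) hy
    exact (abs_majoritySlope_sub_le ⟨hgL c, hh c⟩ hτ0 hτL).trans hε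

theorem mainTheorem2 :
    ∃ K : ℝ, ∀ (n : ℕ) (r₁ L ρ δ : ℝ), 0 < r₁ → 0 < L → 0 < ρ → ρ ≤ 1 / 3 →
      0 < δ → δ ≤ r₁ * n * L / ρ →
      ∃ k₀ : ℕ, ∀ k : ℕ, k₀ ≤ k → ∀ (b : ℕ) (dec : (Fin b → Bool) → ℝ),
        ∃ (W : Type) (_ : Fintype W) (_ : DecidableEq W)
          (A : QuantumQuery.Algorithm ((Fin n → Fin (2 ^ k)) × (Fin b → Bool)) W
            (EuclideanSpace ℝ (Fin n))),
          (A.numQueries : ℝ) ≤ K * Real.log (n / ρ) ∧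
          ∀ (C : Set (EuclideanSpace ℝ (Fin n))) (f : EuclideanSpace ℝ (Fin n) → ℝ)
            (F : (Fin n → Fin (2 ^ k)) → ℝ)
            (U : Matrix.unitaryGroup ((Fin n → Fin (2 ^ k)) × (Fin b → Bool)) ℂ),
            ConvexOn ℝ C f →
            supBall n (2 * r₁) ⊆ C →
            LipschitzOnWith L.toNNReal f (supBall n (2 * r₁)) →
            (∀ j, |F j - f (gridPoint n k (2 * r₁) j)| ≤ δ) →
            IsStandardOracle dec F U →
            1 - ρ ≤ A.prob U {g | ∀ y ∈ C,
              f 0 + inner ℝ g y - 23 ^ 2 * √(δ * n ^ 3 * L / (ρ * r₁)) * ∑ i, |y i|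
                - 2 * L * √n * r₁ ≤ f y ∧
              f 0 + inner ℝ g y - (23 * n) ^ 2 * √(δ * L / (ρ * r₁)) * ‖y‖
                - 2 * L * √n * r₁ ≤ f y} := by
  classical
  obtain ⟨K, hK⟩ := exists_rounds
  refine ⟨K, fun n r L ρ δ hr hL hρ hρ3 hδ hδ' => ?_⟩
  have hn : 0 < n := by
    rcases Nat.eq_zero_or_pos n with h | h
    · subst h
      simp at hδ'
      linarith
    · exact h
  obtain ⟨s, hs, hsρ⟩ := hK n ρ hn hρ hρ3
  obtain ⟨l₀, hl₀⟩ := exists_scale hn hr hL hρ hδ hδ'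
  -- The two extra bits make the grid of the large cube four blocks of `2 ^ l` points wide, the
  -- middle two being the centres.
  refine ⟨l₀ + 2, fun k hk b dec => ?_⟩
  obtain ⟨l, rfl⟩ : ∃ l, k = l + 2 := ⟨k - 2, by omega⟩
  obtain ⟨H, hH0, hH, hτL, hε, havg⟩ := hl₀ l (by omega)
  have hcard : 0 < (centreBox n l).card := by rw [card_centreBox]; positivity
  have : Nonempty ↥(centreBox n l) := (Finset.card_pos.1 hcard).to_subtype
  have : Nonempty (Fin n → Fin (2 ^ (l + 2))) := ⟨gridIndex l 0⟩
  obtain ⟨A, hA, hprob⟩ := exists_fourierSampling_algorithm (n := n) hH0 dec (12 / 100 / δ) (2 * s)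
    (fun (z : ↥(centreBox n l)) y => gridIndex l (z.1 + labelOffset y))
    (majoritySlope n H s (12 / 100 / δ * (r / 2 ^ l)) L)
  refine ⟨_, _, _, A, ?_, fun C f F U hf hC hLip hF hU => ?_⟩
  · rw [hA]; push_cast; exact hs
  · rw [hprob F U hU]
    refine one_sub_le_average (fun z : ↥(centreBox n l) => nonlinearity f r l H z.1) _
      (κ := 24 / 100 * δ) (by positivity) (by linarith) (fun z => ?_) ?_ (fun z => ?_) fun z hN => ?_
    · obtain ⟨g, -, hg⟩ := hf.exists_subgradient_supBall hr hL.le hC hLip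
        (latticePoint_mem_supBall_of_mem_centreBox hr z.2)
      rw [← sum_abs_sub_linear_eq_nonlinearity hr hC hH z.2 hg]
      exact Finset.sum_nonneg fun y _ => mul_nonneg (labelWeight_nonneg y) (abs_nonneg _)
    · rw [Finset.sum_coe_sort (centreBox n l) (fun z => nonlinearity f r l H z), Fintype.card_coe]
      refine (sum_nonlinearity_le hr hL.le hLip hH0 hH).trans ?_
      gcongr
    · exact Finset.sum_nonneg fun h _ => by
        split_ifs
        · positivity
        · exact le_rfl
    · have := le_sum_majoritySlope (s := s) hr hL hδ hf hC hLip hF hH0 hH hτL hε z.2 hN {g | ∀ y ∈ C,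
              f 0 + inner ℝ g y - 23 ^ 2 * √(δ * n ^ 3 * L / (ρ * r)) * ∑ i, |y i|
                - 2 * L * √n * r ≤ f y ∧
              f 0 + inner ℝ g y - (23 * n) ^ 2 * √(δ * L / (ρ * r)) * ‖y‖
                - 2 * L * √n * r ≤ f y} (fun g hg y hy => ⟨hg y hy, ?_⟩)
      · linarith
      · refine le_trans ?_ (hg y hy)
        -- The Euclidean form follows from `‖y‖₁ ≤ √n ‖y‖₂`.
        have h1 : √(δ * n ^ 3 * L / (ρ * r)) * √n = n ^ 2 * √(δ * L / (ρ * r)) := by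
          rw [← Real.sqrt_mul (by positivity), show δ * n ^ 3 * L / (ρ * r) * n =
            (n ^ 2) ^ 2 * (δ * L / (ρ * r)) by ring, Real.sqrt_mul (by positivity),
            Real.sqrt_sq (by positivity)]
        have h2 : 23 ^ 2 * √(δ * n ^ 3 * L / (ρ * r)) * ∑ i, |y i| ≤
            23 ^ 2 * √(δ * n ^ 3 * L / (ρ * r)) * (√n * ‖y‖) := by
          gcongr
          exact EuclideanSpace.sum_abs_le y
        have h3 : 23 ^ 2 * √(δ * n ^ 3 * L / (ρ * r)) * (√n * ‖y‖) =
            (23 * n) ^ 2 * √(δ * L / (ρ * r)) * ‖y‖ := by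
          rw [show 23 ^ 2 * √(δ * n ^ 3 * L / (ρ * r)) * (√n * ‖y‖) =
            23 ^ 2 * (√(δ * n ^ 3 * L / (ρ * r)) * √n) * ‖y‖ by ring, h1]
          ring
        linarith
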